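/- **Graph notions.** A graph $E=(E^0,E^1,r,s)$ consists of a set $E^0$ of vertices, a set $E^1$ of edges (both possibly infinite) and maps $s,r:E^1\to E^0$ (source and range). $\mathrm{Path}(E)$ is the set of finite paths $x=e_1\cdots e_n$ with $r(e_i)=s(e_{i+1})$, of length $|x|=n$, including the vertices as paths of length $0$; $s(x)$ and $r(x)$ denote source and range. $E$ has no sinks if $s^{-1}(v)\neq\emptyset$ for all $v\in E^0$; $E$ is row-finite if $s^{-1}(v)$ is finite for all $v\in E^0$; $v$ is regular if $s^{-1}(v)$ is finite and nonempty. $E$ satisfies (Y) if for every natural number $n$ and every infinite path $p$ in $E$ there are an initial subpath $x$ of $p$ and a path $y\in\mathrm{Path}(E)$ with $r(y)=r(x)$ and $|y|-|x|=n$. **Graph inverse semigroup.** $\mathcal S(E)$ is the semigroup with zero generated by $E^0\cup E^1\cup\{e^{-1}\mid e\in E^1\}$ subject to $vw=\delta_{v,w}v$, $s(e)e=er(e)=e$, $r(e)e^{-1}=e^{-1}s(e)=e^{-1}$ and $e^{-1}f=\delta_{e,f}r(e)$, for $v,w\in E^0$ and $e,f\in E^1$. It is an inverse semigroup whose nonzero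 elements are $xy^{-1}$ with $x,y\in\mathrm{Path}(E)$, $r(x)=r(y)$. In the natural $\mathbb Z$-grading, $\mathcal S(E)_n$ consists of $0$ and all such $xy^{-1}$ with $|x|-|y|=n$. For an inverse semigroup $S$, $E(S)$ is its set of idempotents, and $s\le t$ means $s=tu$ for some $u\in E(S)$. A grading $(S_n)_{n\in\mathbb Z}$ of $S$ is *locally strong* if for all $m,n\in\mathbb Z$ and $s\in S_{m+n}\setminus\{0\}$ there is $t\in S_mS_n\setminus\{0\}$ with $t\le s$. It is *saturated strong* if for every $n\in\mathbb Z$ and every infinite strictly descending chain of idempotents $u_0>u_1>\cdots$ with $u_0$ a maximal idempotent, there are $k\ge0$ and $v\in\{ss^{-1}\mid s\in S_n\}$ with $u_0\ge v\ge u_k$. **Leavitt path algebra.** For a field $K$, $L_K(E)$ is the quotient of the contracted semigroup ring $K[\mathcal S(E)]$ (the semigroup ring modulo the ideal generated by the zero of $\mathcal S(E)$) by the ideal generated by the elements $v-\sum_{e\in s^{-1}(v)}ee^{-1}$, for $v\in E^0$ regular. It is $\mathbb Z$-graded, $L_K(E)_n$ being the image of the span of $\mathcal S(E)_n$. A $\mathbb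 Z$-graded ring $A=\bigoplus_n A_n$ is strongly graded if $A_mA_n=A_{m+n}$ for all $m,n$, where $A_mA_n$ is the set of finite sums of products $ab$ with $a\in A_m$, $b\in A_n$. **Boundary path groupoid.** The set $\partial E$ of boundary paths consists of the infinite paths and of the finite paths $x$ with $r(x)$ not regular. $\mathscr G_E$ is the groupoid with unit space $\partial E$ of all triples $(\alpha z,|\alpha|-|\beta|,\beta z)$ with $\alpha,\beta\in\mathrm{Path}(E)$, $z\in\partial E$, $r(\alpha)=r(\beta)=s(z)$, where $(x,k,y)$ has domain $y$ and range $x$, $(x,k,y)(y,l,z)=(x,k+l,z)$ and $(x,k,y)^{-1}=(y,-k,x)$. Its natural $\mathbb Z$-grading is $(x,k,y)\mapsto k$. It is strongly graded if $\mathscr G_m\mathscr G_n=\mathscr G_{m+n}$ for all $m,n\in\mathbb Z$, where $\mathscr G_n$ is the set of elements of degree $n$. **Corollary.** Let $E$ be a nonempty graph. Then the following are equivalent. 1. $E$ has no sinks, is row-finite, and satisfies condition (Y). 2. $L_K(E)$ is strongly graded in the natural $\mathbb Z$-grading, for any field $K$ (that is, for every field $K$; equivalently, for at least one field $K$). 3.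 $\mathscr G_E$ is strongly graded in the natural $\mathbb Z$-grading. 4. For every maximal idempotent $u$ in $\mathcal S(E)$ there are only finitely many maximal elements in $\{v\in E(\mathcal S(E))\mid v<u\}$, and $\mathcal S(E)$ is both locally strongly graded and saturated strongly graded in the natural $\mathbb Z$-grading. -/

import Mathlib

universe u v w

namespace GraphGrading

open CategoryTheory

/-! ### Directed graphs and paths -/

/-- A directed graph `(E⁰, E¹, r, s)`; loops and parallel edges are allowed, and both sets may be
infinite. -/
structure DirectedGraph where
  /-- the set `E⁰` of vertices -/
  Vertex : Type u
  /-- the set `E¹` of edges -/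
  Edge : Type v
  /-- the source map -/
  s : Edge → Vertex
  /-- the range map -/
  r : Edge → Vertex

namespace DirectedGraph

/-- `E` has no sinks: every vertex emits an edge. -/
def NoSinks (E : DirectedGraph.{u, v}) : Prop :=
  ∀ a : E.Vertex, {e | E.s e = a}.Nonempty

/-- `E` is row-finite: every vertex emits finitely many edges. -/
def RowFinite (E : DirectedGraph.{u, v}) : Prop :=
  ∀ a : E.Vertex, {e | E.s e = a}.Finite

/-- A vertex is regular if it emits at least one and only finitely many edges. -/
def IsRegular (E : DirectedGraph.{u, v}) (a : E.Vertex) : Prop :=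
  {e | E.s e = a}.Nonempty ∧ {e | E.s e = a}.Finite

/-- `E.IsWalk a l b`: the list of edges `l` is composable, starts at `a` and ends at `b`; the empty
list is a walk from `a` to `a`. -/
def IsWalk (E : DirectedGraph.{u, v}) : E.Vertex → List E.Edge → E.Vertex → Prop
  | a, [], b => a = b
  | a, e :: l, b => E.s e = a ∧ E.IsWalk (E.r e) l b

theorem IsWalk.append {E : DirectedGraph.{u, v}} {b c : E.Vertex} {l' : List E.Edge}
    (h' : E.IsWalk b l' c) :
    ∀ {l : List E.Edge} {a : E.Vertex}, E.IsWalk a l b → E.IsWalk a (l ++ l') c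
  | [], _, h => by cases h; exact h'
  | _ :: _, _, h => ⟨h.1, IsWalk.append h' h.2⟩

theorem IsWalk.range_unique {E : DirectedGraph.{u, v}} {b c : E.Vertex} :
    ∀ {l : List E.Edge} {a : E.Vertex}, E.IsWalk a l b → E.IsWalk a l c → b = c
  | [], _, h, h' => by cases h; exact h'
  | _ :: _, _, h, h' => IsWalk.range_unique h.2 h'.2

theorem IsWalk.of_append {E : DirectedGraph.{u, v}} {c : E.Vertex} {l' : List E.Edge} :
    ∀ {l : List E.Edge} {a b : E.Vertex}, E.IsWalk a l b → E.IsWalk a (l ++ l') c →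
      E.IsWalk b l' c
  | [], _, _, h, h' => by cases h; exact h'
  | _ :: _, _, _, h, h' => IsWalk.of_append h.2 h'.2

/-- An element of `Path(E)`: a finite path in `E`. The paths with no edges are the vertices. -/
structure Path (E : DirectedGraph.{u, v}) where
  /-- the source of the path -/
  source : E.Vertex
  /-- the edges of the path, in order -/
  edges : List E.Edge
  /-- the range of the path -/
  range : E.Vertex
  isWalk : E.IsWalk source edges range

namespace Path

variable {E : DirectedGraph.{u, v}}

/-- The length `|x|`. -/
def length (x : E.Path) : ℕ := x.edges.length

/-- A vertex, as a path of length `0`. -/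
def ofVertex (a : E.Vertex) : E.Path := ⟨a, [], a, rfl⟩

/-- Concatenation of paths. -/
def comp (x y : E.Path) (h : x.range = y.source) : E.Path :=
  ⟨x.source, x.edges ++ y.edges, y.range, IsWalk.append y.isWalk (h ▸ x.isWalk)⟩

theorem ext' {x y : E.Path} (h : x.source = y.source) (h' : x.edges = y.edges) : x = y := by
  obtain ⟨a, l, b, w⟩ := x
  obtain ⟨a', l', b', w'⟩ := y
  obtain rfl : a = a' := h
  obtain rfl : l = l' := h'
  obtain rfl : b = b' := w.range_unique w'
  rfl

end Path

/-- An infinite path `e₁e₂⋯` in `E`. -/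
structure InfinitePath (E : DirectedGraph.{u, v}) where
  /-- the sequence of edges -/
  edges : Stream' E.Edge
  chain : ∀ n, E.r (edges.get n) = E.s (edges.get (n + 1))

namespace InfinitePath

variable {E : DirectedGraph.{u, v}}

/-- The source of an infinite path is the source of its first edge. -/
def source (p : E.InfinitePath) : E.Vertex := E.s (p.edges.get 0)

theorem chain_append (p : E.InfinitePath) : ∀ {l : List E.Edge} {a : E.Vertex},
    E.IsWalk a l p.source → E.s ((l ++ₛ p.edges).get 0) = a ∧
      ∀ n, E.r ((l ++ₛ p.edges).get n) = E.s ((l ++ₛ p.edges).get (n + 1))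
  | [], _, h => ⟨h.symm, p.chain⟩
  | _ :: _, _, h => by
    have ih := chain_append p h.2
    refine ⟨h.1, fun n => ?_⟩
    cases n with
    | zero => exact ih.1.symm
    | succ n => exact ih.2 n

/-- The infinite path `xp`, for a finite path `x` and an infinite path `p` with `r(x) = s(p)`. -/
def prepend (x : E.Path) (p : E.InfinitePath) (h : x.range = p.source) : E.InfinitePath :=
  ⟨x.edges ++ₛ p.edges, (p.chain_append (h ▸ x.isWalk)).2⟩

/-- `x` is an initial subpath of `p`: `p = xq` for some infinite path `q`. -/
def IsInitial (x : E.Path) (p : E.InfinitePath) : Prop :=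
  ∃ (q : E.InfinitePath) (h : x.range = q.source), p = prepend x q h

end InfinitePath

/-- Condition (Y): for every natural number `n` and every infinite path `p` there are an initial
subpath `x` of `p` and a path `y` with `r(y) = r(x)` and `|y| - |x| = n`. -/
def ConditionY (E : DirectedGraph.{u, v}) : Prop :=
  ∀ (n : ℕ) (p : E.InfinitePath), ∃ x y : E.Path,
    InfinitePath.IsInitial x p ∧ y.range = x.range ∧ (y.length : ℤ) - (x.length : ℤ) = n

end DirectedGraph

/-! ### Semigroups with zero: natural order and gradings -/

section Semigroup

variable {S : Type*} [SemigroupWithZero S] {Γ : Type*} [AddGroup Γ]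

/-- The set `E(S)` of idempotents. -/
def Idempotents (S : Type*) [SemigroupWithZero S] : Set S := {u | u * u = u}

/-- `t` is the inverse of `s`, in the sense of inverse semigroups. -/
def IsInverseOf (t s : S) : Prop := s * t * s = s ∧ t * s * t = t

/-- The natural partial order of an inverse semigroup: `s ≤ t` if `s = tu` for an idempotent `u`. -/
def NatLE (s t : S) : Prop := ∃ u ∈ Idempotents S, s = t * u

/-- The strict natural order. -/
def NatLT (s t : S) : Prop := NatLE s t ∧ s ≠ t

/-- `u` is a maximal element of the set `A`, with respect to the natural order. -/
def IsMaximalIn (A : Set S) (u : S) : Prop := u ∈ A ∧ ∀ w ∈ A, NatLE u w → w = u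

/-- For every maximal idempotent `u`, there are only finitely many maximal elements in the set of
idempotents strictly below `u`. -/
def FinitelyManyMaximalBelow (S : Type*) [SemigroupWithZero S] : Prop :=
  ∀ u, IsMaximalIn (Idempotents S) u →
    {w | IsMaximalIn {w' ∈ Idempotents S | NatLT w' u} w}.Finite

/-- `E(S)_α = {ss⁻¹ ∣ s ∈ S_α}`, for a family `S_α` of subsets of an inverse semigroup. -/
def IdempotentsOfDegree (𝒮 : Γ → Set S) (α : Γ) : Set S :=
  {u | ∃ s ∈ 𝒮 α, ∃ t, IsInverseOf t s ∧ u = s * t}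

/-- An inverse semigroup with components `S_α` is locally strongly graded if for every nonzero
`s ∈ S_{α+β}` there is a nonzero `t ∈ S_α S_β` with `t ≤ s`. -/
def LocallyStronglyGraded (𝒮 : Γ → Set S) : Prop :=
  ∀ (α β : Γ), ∀ s ∈ 𝒮 (α + β), s ≠ 0 →
    ∃ a ∈ 𝒮 α, ∃ b ∈ 𝒮 β, a * b ≠ 0 ∧ NatLE (a * b) s

/-- An inverse semigroup with components `S_α` is saturated strongly graded if for every `α` and
every infinite strictly descending chain of idempotents `u₀ > u₁ > ⋯` with `u₀` maximal there are
`n` and `w ∈ E(S)_α` with `u₀ ≥ w ≥ uₙ`. -/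
def SaturatedStronglyGraded (𝒮 : Γ → Set S) : Prop :=
  ∀ (α : Γ) (u : ℕ → S), (∀ n, u n ∈ Idempotents S) → (∀ n, NatLT (u (n + 1)) (u n)) →
    IsMaximalIn (Idempotents S) (u 0) →
      ∃ n, ∃ w ∈ IdempotentsOfDegree 𝒮 α, NatLE w (u 0) ∧ NatLE (u n) w

end Semigroup

/-! ### The graph inverse semigroup -/

namespace DirectedGraph

/-- The generators of `S(E)`: the vertices `a`, the edges `e`, and their formal inverses `e⁻¹`. -/
inductive Generator (E : DirectedGraph.{u, v}) : Type (max u v)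
  | vertex (a : E.Vertex)
  | edge (e : E.Edge)
  | edgeInv (e : E.Edge)

/-- The free semigroup with zero on the generators. -/
abbrev FreeSemigroupWithZero (E : DirectedGraph.{u, v}) : Type (max u v) :=
  WithZero (FreeSemigroup E.Generator)

/-- A generator, as an element of the free semigroup with zero. -/
def Generator.toFree {E : DirectedGraph.{u, v}} (g : E.Generator) : E.FreeSemigroupWithZero :=
  ((FreeSemigroup.of g : FreeSemigroup E.Generator) : WithZero (FreeSemigroup E.Generator))

open Generator in
/-- The defining relations (V), (E1), (E2), (CK1) of `S(E)`. -/
inductive DefiningRel (E : DirectedGraph.{u, v}) :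
    E.FreeSemigroupWithZero → E.FreeSemigroupWithZero → Prop
  | vertex_mul_self (a : E.Vertex) :
      DefiningRel E ((vertex a).toFree * (vertex a).toFree) (vertex a).toFree
  | vertex_mul_of_ne {a b : E.Vertex} (h : a ≠ b) :
      DefiningRel E ((vertex a).toFree * (vertex b).toFree) 0
  | source_mul_edge (e : E.Edge) :
      DefiningRel E ((vertex (E.s e)).toFree * (edge e).toFree) (edge e).toFree
  | edge_mul_range (e : E.Edge) :
      DefiningRel E ((edge e).toFree * (vertex (E.r e)).toFree) (edge e).toFree
  | range_mul_edgeInv (e : E.Edge) :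
      DefiningRel E ((vertex (E.r e)).toFree * (edgeInv e).toFree) (edgeInv e).toFree
  | edgeInv_mul_source (e : E.Edge) :
      DefiningRel E ((edgeInv e).toFree * (vertex (E.s e)).toFree) (edgeInv e).toFree
  | edgeInv_mul_self (e : E.Edge) :
      DefiningRel E ((edgeInv e).toFree * (edge e).toFree) (vertex (E.r e)).toFree
  | edgeInv_mul_of_ne {e f : E.Edge} (h : e ≠ f) :
      DefiningRel E ((edgeInv e).toFree * (edge f).toFree) 0

/-- The congruence generated by the defining relations. -/
def congruence (E : DirectedGraph.{u, v}) : Con E.FreeSemigroupWithZero := conGen E.DefiningRel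

/-- The graph inverse semigroup `S(E)`: the semigroup with zero that is generated by the vertices,
the edges and their inverses, subject to the defining relations. -/
def GraphInverseSemigroup (E : DirectedGraph.{u, v}) : Type (max u v) := E.congruence.Quotient

namespace GraphInverseSemigroup

variable {E : DirectedGraph.{u, v}}

/-- The quotient map from the free semigroup with zero. -/
def mk (w : E.FreeSemigroupWithZero) : E.GraphInverseSemigroup := Con.toQuotient (c := E.congruence) w

instance : SemigroupWithZero E.GraphInverseSemigroup :=
  { (inferInstance : Semigroup E.congruence.Quotient) with
    zero := mk 0
    zero_mul := fun x => Con.induction_on (c := E.congruence) x fun w =>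
      congrArg mk (zero_mul w)
    mul_zero := fun x => Con.induction_on (c := E.congruence) x fun w =>
      congrArg mk (mul_zero w) }

/-- The element `a` of `S(E)`, for a vertex `a`. -/
def vertex (a : E.Vertex) : E.GraphInverseSemigroup := mk (Generator.vertex a).toFree

/-- The element `e` of `S(E)`, for an edge `e`. -/
def edge (e : E.Edge) : E.GraphInverseSemigroup := mk (Generator.edge e).toFree

/-- The element `e⁻¹` of `S(E)`, for an edge `e`. -/
def edgeInv (e : E.Edge) : E.GraphInverseSemigroup := mk (Generator.edgeInv e).toFree

/-- The element `x = s(x)e₁⋯eₙ` of `S(E)`, for a path `x = e₁⋯eₙ`; the factor `s(x)` is absorbed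
if `n ≥ 1`. -/
def path (x : E.Path) : E.GraphInverseSemigroup :=
  x.edges.foldl (fun w e => w * edge e) (vertex x.source)

/-- The element `x⁻¹ = eₙ⁻¹⋯e₁⁻¹s(x)` of `S(E)`, for a path `x = e₁⋯eₙ`; the factor `s(x)` is
absorbed if `n ≥ 1`. -/
def pathInv (x : E.Path) : E.GraphInverseSemigroup :=
  x.edges.foldl (fun w e => edgeInv e * w) (vertex x.source)

/-- The components of the natural `ℤ`-grading of `S(E)`: the component of degree `n` consists of
`0` and of the elements `xy⁻¹` with `r(x) = r(y)` and `|x| - |y| = n`. -/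
def component (E : DirectedGraph.{u, v}) (n : ℤ) : Set E.GraphInverseSemigroup :=
  {w | w = 0 ∨ ∃ x y : E.Path, x.range = y.range ∧ (x.length : ℤ) - (y.length : ℤ) = n ∧
    w = path x * pathInv y}

end GraphInverseSemigroup

end DirectedGraph

/-! ### Graded rings and Leavitt path algebras -/

/-- A family `A_α` of additive subgroups makes the (not necessarily unital) ring `A` a strongly
graded ring: `A` is the internal direct sum of the `A_α`, and `A_α A_β = A_{α+β}`, where `A_α A_β`
is the set of all finite sums of products `ab` with `a ∈ A_α`, `b ∈ A_β`. -/
def StronglyGradedRing {A : Type*} [NonUnitalRing A] {Γ : Type*} [AddGroup Γ] [DecidableEq Γ]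
    (𝒜 : Γ → AddSubgroup A) : Prop :=
  DirectSum.IsInternal 𝒜 ∧
    ∀ α β, AddSubgroup.closure {c | ∃ a ∈ 𝒜 α, ∃ b ∈ 𝒜 β, c = a * b} = 𝒜 (α + β)

section Contracted

variable (K : Type*) [Field K] (S : Type*) [SemigroupWithZero S]

/-- The ideal of the semigroup ring `KS` generated by the zero of `S`. -/
noncomputable def zeroIdeal : TwoSidedIdeal (MonoidAlgebra K S) :=
  TwoSidedIdeal.span {MonoidAlgebra.single 0 1}

/-- The contracted semigroup ring `K[S] = KS/I`, where `I` is generated by the zero of `S`. -/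
def ContractedSemigroupRing : Type _ := (zeroIdeal K S).ringCon.Quotient

noncomputable instance : NonUnitalRing (ContractedSemigroupRing K S) :=
  inferInstanceAs (NonUnitalRing (zeroIdeal K S).ringCon.Quotient)

variable {S}

/-- The quotient map `KS → K[S]`. -/
noncomputable def ContractedSemigroupRing.mk :
    MonoidAlgebra K S →ₙ+* ContractedSemigroupRing K S where
  toFun := RingCon.toQuotient (c := (zeroIdeal K S).ringCon)
  map_mul' _ _ := rfl
  map_zero' := rfl
  map_add' _ _ := rfl

/-- The element `ks` of `K[S]`. -/
noncomputable def contractedSingle (s : S) (k : K) : ContractedSemigroupRing K S :=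
  ContractedSemigroupRing.mk K (MonoidAlgebra.single s k)

end Contracted

namespace DirectedGraph

section Leavitt

variable (E : DirectedGraph.{u, v}) (K : Type w) [Field K]

/-- The Cohn path algebra `C_K(E) = K[S(E)]`. -/
abbrev CohnPathAlgebra : Type _ := ContractedSemigroupRing K E.GraphInverseSemigroup

open GraphInverseSemigroup in
/-- The ideal of `K[S(E)]` generated by the elements `a - ∑_{s(e) = a} ee⁻¹`, for `a` a regular
vertex (so that the sum is finite). -/
noncomputable def cuntzKriegerIdeal : TwoSidedIdeal (E.CohnPathAlgebra K) :=
  TwoSidedIdeal.span {c | ∃ a : E.Vertex, E.IsRegular a ∧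
    c = contractedSingle K (vertex a) 1 -
      ∑ᶠ e ∈ {e | E.s e = a}, contractedSingle K (edge e * edgeInv e) 1}

/-- The Leavitt path algebra `L_K(E)`. -/
def LeavittPathAlgebra : Type _ := (E.cuntzKriegerIdeal K).ringCon.Quotient

noncomputable instance : NonUnitalRing (E.LeavittPathAlgebra K) :=
  inferInstanceAs (NonUnitalRing (E.cuntzKriegerIdeal K).ringCon.Quotient)

/-- The quotient map `C_K(E) → L_K(E)`. -/
noncomputable def LeavittPathAlgebra.mk : E.CohnPathAlgebra K →ₙ+* E.LeavittPathAlgebra K where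
  toFun := RingCon.toQuotient (c := (E.cuntzKriegerIdeal K).ringCon)
  map_mul' _ _ := rfl
  map_zero' := rfl
  map_add' _ _ := rfl

/-- The component of degree `n` of the natural `ℤ`-grading of `L_K(E)`: the finite sums of the
images of the elements `kw` with `k ∈ K` and `w ∈ S(E)_n`. -/
noncomputable def leavittComponent (n : ℤ) : AddSubgroup (E.LeavittPathAlgebra K) :=
  AddSubgroup.closure {c | ∃ w ∈ GraphInverseSemigroup.component E n, ∃ k : K,
    c = LeavittPathAlgebra.mk E K (contractedSingle K w k)}

end Leavitt

end DirectedGraph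

/-! ### Graded groupoids and the boundary path groupoid -/

/-- A groupoid graded by the functor `φ` to the group `Γ` is strongly graded if
`𝒢_α 𝒢_β = 𝒢_{αβ}` for all `α`, `β`, where `𝒢_α` is the set of morphisms `f` with `φ f = α`. The
product `fg` of two morphisms, defined if the domain of `f` is the range of `g`, is `g ≫ f`; the
inclusion `𝒢_α 𝒢_β ⊆ 𝒢_{αβ}` holds since `φ` is a functor. -/
def StronglyGradedGroupoid {G : Type*} [Groupoid G] {Γ : Type*} [Group Γ]
    (φ : G ⥤ SingleObj Γ) : Prop :=
  ∀ (α β : Γ) {a b : G} (f : a ⟶ b), φ.map f = α * β →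
    ∃ (c : G) (g : c ⟶ b) (h : a ⟶ c), φ.map g = α ∧ φ.map h = β ∧ h ≫ g = f

namespace DirectedGraph

/-- The boundary path space of `E`: the infinite paths, and the finite paths whose range is not a
regular vertex (that is, a sink or an infinite emitter). These are the units of the boundary path
groupoid. -/
inductive BoundaryPath (E : DirectedGraph.{u, v}) : Type (max u v)
  | infinite (p : E.InfinitePath)
  | finite (x : E.Path) (h : ¬ E.IsRegular x.range)

namespace BoundaryPath

variable {E : DirectedGraph.{u, v}}

/-- The source of a boundary path. -/
def source : E.BoundaryPath → E.Vertex
  | infinite p => p.source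
  | finite x _ => x.source

/-- The boundary path `xz`, for a finite path `x` and a boundary path `z` with `r(x) = s(z)`. -/
def prepend (x : E.Path) : (z : E.BoundaryPath) → x.range = z.source → E.BoundaryPath
  | infinite p, h => infinite (InfinitePath.prepend x p h)
  | finite y hy, h => finite (x.comp y h) hy

theorem source_prepend (x : E.Path) (z : E.BoundaryPath) (h : x.range = z.source) :
    (prepend x z h).source = x.source := by
  cases z with
  | infinite p =>
    have h' : x.range = p.source := h
    exact (p.chain_append (h' ▸ x.isWalk)).1
  | finite y hy => rfl

theorem prepend_ofVertex (z : E.BoundaryPath) :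
    prepend (Path.ofVertex z.source) z rfl = z := by
  cases z <;> rfl

theorem prepend_comp (x y : E.Path) (z : E.BoundaryPath) (h : x.range = y.source)
    (h' : y.range = z.source) :
    prepend (x.comp y h) z h' =
      prepend x (prepend y z h') (h.trans (source_prepend y z h').symm) := by
  cases z with
  | infinite p =>
    simp only [prepend, InfinitePath.prepend, Path.comp, Stream'.append_append_stream]
  | finite w hw =>
    simp only [prepend, Path.comp, List.append_assoc]

theorem stream_append_eq {α : Type*} {l l' : List α} {p q : Stream' α}
    (h : l ++ₛ p = l' ++ₛ q) (hl : l.length ≤ l'.length) :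
    ∃ t, l' = l ++ t ∧ p = t ++ₛ q := by
  induction l generalizing l' with
  | nil => exact ⟨l', rfl, h⟩
  | cons a l ih =>
    cases l' with
    | nil => simp at hl
    | cons b l' =>
      have h0 : a = b := congrFun h 0
      have h1 : l ++ₛ p = l' ++ₛ q := funext fun n => congrFun h (n + 1)
      obtain ⟨t, rfl, ht⟩ := ih h1 (by simpa using hl)
      exact ⟨t, by rw [h0]; rfl, ht⟩

theorem prepend_eq_prepend {x y : E.Path} {z w : E.BoundaryPath} {hx : x.range = z.source}
    {hy : y.range = w.source} (h : prepend x z hx = prepend y w hy) (hl : x.length ≤ y.length) :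
    ∃ (t : E.Path) (h₁ : x.range = t.source) (h₂ : t.range = w.source),
      y = x.comp t h₁ ∧ z = prepend t w h₂ := by
  have hs : x.source = y.source := by
    rw [← source_prepend x z hx, h, source_prepend]
  have key : ∀ t : List E.Edge, y.edges = x.edges ++ t → E.IsWalk x.range t y.range :=
    fun t ht => x.isWalk.of_append (by rw [← ht, hs]; exact y.isWalk)
  cases z with
  | infinite p =>
    cases w with
    | finite _ _ => simp [prepend] at h
    | infinite q =>
      simp only [prepend, InfinitePath.prepend, infinite.injEq, InfinitePath.mk.injEq] at h
      obtain ⟨t, ht, hp⟩ := stream_append_eq h hl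
      refine ⟨⟨x.range, t, y.range, key t ht⟩, rfl, hy, Path.ext' hs.symm ht, ?_⟩
      cases p
      cases hp
      rfl
  | finite p hp =>
    cases w with
    | infinite _ => simp [prepend] at h
    | finite q hq =>
      simp only [prepend, finite.injEq, Path.comp, Path.mk.injEq] at h
      have hpre : ∃ t, y.edges = x.edges ++ t ∧ p.edges = t ++ q.edges := by
        rcases List.append_eq_append_iff.1 h.2.1 with ht | ⟨t, ht, hpt⟩
        · exact ht
        · have h0 : t = [] := by
            have h2 := congrArg List.length ht
            rw [List.length_append] at h2
            change x.edges.length ≤ y.edges.length at hl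
            exact List.length_eq_zero_iff.1 (by omega)
          subst h0
          exact ⟨[], by simpa using ht.symm, by simpa using hpt.symm⟩
      obtain ⟨t, ht, hpt⟩ := hpre
      refine ⟨⟨x.range, t, y.range, key t ht⟩, rfl, hy, Path.ext' hs.symm ht, ?_⟩
      have hpq : p = Path.comp ⟨x.range, t, y.range, key t ht⟩ q hy := Path.ext' hx.symm hpt
      subst hpq
      rfl

/-- `TailEquiv k x y`: the triple `(x, k, y)` is an element of the boundary path groupoid, that is,
`x = αz`, `y = βz` and `k = |α| - |β|` for finite paths `α`, `β` and a boundary path `z` with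
`r(α) = s(z) = r(β)`. -/
def TailEquiv (k : ℤ) (x y : E.BoundaryPath) : Prop :=
  ∃ (α β : E.Path) (z : E.BoundaryPath) (hα : α.range = z.source) (hβ : β.range = z.source),
    prepend α z hα = x ∧ prepend β z hβ = y ∧ k = (α.length : ℤ) - (β.length : ℤ)

theorem TailEquiv.refl (x : E.BoundaryPath) : TailEquiv 0 x x :=
  ⟨Path.ofVertex x.source, Path.ofVertex x.source, x, rfl, rfl, prepend_ofVertex x,
    prepend_ofVertex x, by simp⟩

theorem TailEquiv.symm {k : ℤ} {x y : E.BoundaryPath} (h : TailEquiv k x y) :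
    TailEquiv (-k) y x := by
  obtain ⟨α, β, z, hα, hβ, h1, h2, rfl⟩ := h
  exact ⟨β, α, z, hβ, hα, h2, h1, by ring⟩

theorem TailEquiv.trans {k l : ℤ} {x y z : E.BoundaryPath} (h : TailEquiv k x y)
    (h' : TailEquiv l y z) : TailEquiv (k + l) x z := by
  obtain ⟨α, β, w, hα, hβ, rfl, h2, rfl⟩ := h
  obtain ⟨γ, δ, w', hγ, hδ, h3, rfl, rfl⟩ := h'
  rcases le_total β.length γ.length with hl | hl
  · obtain ⟨t, h₁, h₂, rfl, rfl⟩ := prepend_eq_prepend (h2.trans h3.symm) hl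
    refine ⟨α.comp t (by rw [hα, ← hβ, h₁]), δ, w', h₂, hδ, prepend_comp _ _ _ _ _, rfl, ?_⟩
    simp only [Path.length, Path.comp, List.length_append]
    push_cast
    ring
  · obtain ⟨t, h₁, h₂, rfl, rfl⟩ := prepend_eq_prepend (h3.trans h2.symm) hl
    refine ⟨α, δ.comp t (by rw [hδ, ← hγ, h₁]), w, hα, h₂, rfl, prepend_comp _ _ _ _ _, ?_⟩
    simp only [Path.length, Path.comp, List.length_append]
    push_cast
    ring

/-- The boundary path groupoid: its objects are the boundary paths, and its morphisms from `y`
to `x` are the triples `(x, k, y)` as above, with `(x, k, y)(y, l, z) = (x, k + l, z)` and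
`(x, k, y)⁻¹ = (y, -k, x)`. -/
instance : Groupoid E.BoundaryPath where
  Hom y x := {k : ℤ // TailEquiv k x y}
  id x := ⟨0, TailEquiv.refl x⟩
  comp f g := ⟨g.1 + f.1, g.2.trans f.2⟩
  id_comp _ := Subtype.ext (add_zero _)
  comp_id _ := Subtype.ext (zero_add _)
  assoc _ _ _ := Subtype.ext (add_assoc _ _ _).symm
  inv f := ⟨-f.1, f.2.symm⟩
  inv_comp _ := Subtype.ext (add_neg_cancel _)
  comp_inv _ := Subtype.ext (neg_add_cancel _)

/-- The natural `ℤ`-grading `(x, k, y) ↦ k` of the boundary path groupoid. -/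
def grading (E : DirectedGraph.{u, v}) : E.BoundaryPath ⥤ SingleObj (Multiplicative ℤ) where
  obj _ := SingleObj.star _
  map f := Multiplicative.ofAdd f.1
  map_id _ := rfl
  map_comp _ _ := rfl

end BoundaryPath

end DirectedGraph

end GraphGrading

/-!
All the conditions are equivalent to one statement about the boundary path groupoid, `AllShifts`:
every boundary path `p` and every integer `m` admit a groupoid element `(p, m, c)`, that is,
`p = αz` and `c = βz` with `|α| - |β| = m`. This is a restatement of the strong grading of the
groupoid, since `(x, k + l, y) = (x, k, c)(c, l, y)` as soon as `(x, k, c)` exists. If `E` has a sink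
or an infinite emitter, then that vertex is a boundary path of length zero and has no shift by `1`;
if all vertices are regular, then the boundary paths are the infinite paths, and a shift by `m ≥ 0`
always exists, while the shifts by `m < 0` are condition (Y) (`allShifts_iff`).

For `S(E)`, the action on the finite paths by partial bijections, in which `xy⁻¹` maps `yt` to `xt`,
shows that the representation of a nonzero element as `xy⁻¹` is unique. The nonzero idempotents are
thus the `xx⁻¹`, ordered by extension of paths: the maximal ones are the vertices, the maximal ones
below a vertex are the `ee⁻¹`, and a strictly descending chain is an infinite path. With that
dictionary the conditions on `S(E)` become row-finiteness, the absence of sinks and (Y), and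
`AllShifts` provides the factorizations of elements and the idempotents of prescribed degree.

For `L_K(E)`, the natural grading is internal because `S(E)` is graded away from zero and the
Cuntz–Krieger relations are homogeneous, so that the projections to the components are well defined
on the quotient (`isInternal_leavittComponent`). Given `AllShifts`, each vertex lies in
`L_K(E)_m L_K(E)_{-m}` (`vertex_mem_componentMul`): a failure would propagate, via
`xx⁻¹ = ∑ xe(xe)⁻¹`, along an infinite path, and a shift `(αz, m, βz)` of that path stops it at `α`,
as `αα⁻¹ = (αβ⁻¹)(βα⁻¹)`. Since the vertices are local units, this is strong grading. Conversely,
`L_K(E)` acts on the free `K`-module over the boundary paths; if `p` has no shift by `m`, then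
`L_K(E)_{-m}` annihilates `p`, whereas the vertex `s(p)` fixes `p`, so that `s(p)` is not in
`L_K(E)_m L_K(E)_{-m}` (`allShifts_of_stronglyGradedRing`).
-/

/-! ### Finite paths -/

namespace GraphGrading

namespace DirectedGraph

namespace Path

variable {E : DirectedGraph.{u, v}}

/-- The path `ex`, for an edge `e` and a path `x` with `r(e) = s(x)`. -/
def cons (e : E.Edge) (x : E.Path) (h : E.r e = x.source) : E.Path :=
  ⟨E.s e, e :: x.edges, x.range, rfl, h ▸ x.isWalk⟩

/-- An edge, as a path of length `1`. -/
def ofEdge (e : E.Edge) : E.Path := cons e (ofVertex (E.r e)) rfl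

@[elab_as_elim]
theorem cons_induction {P : E.Path → Prop} (ofVertex : ∀ a, P (ofVertex a))
    (cons : ∀ e x (h : E.r e = x.source), P x → P (cons e x h)) (x : E.Path) : P x := by
  obtain ⟨a, l, b, w⟩ := x
  induction l generalizing a with
  | nil => cases w; exact ofVertex _
  | cons e l ih =>
    obtain ⟨rfl, w⟩ := w
    exact cons e ⟨E.r e, l, b, w⟩ rfl (ih _ w)

theorem length_comp (x y : E.Path) (h : x.range = y.source) :
    (x.comp y h).length = x.length + y.length :=
  List.length_append

@[simp]
theorem length_ofVertex (a : E.Vertex) : (ofVertex a).length = 0 := rfl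

theorem length_cons (e : E.Edge) (x : E.Path) (h : E.r e = x.source) :
    (cons e x h).length = x.length + 1 := rfl

theorem ofVertex_comp {a : E.Vertex} (x : E.Path) (h : a = x.source) :
    (ofVertex a).comp x h = x := ext' h rfl

theorem comp_ofVertex {a : E.Vertex} (x : E.Path) (h : x.range = a) :
    x.comp (ofVertex a) h = x := ext' rfl (List.append_nil _)

theorem comp_of_length_eq_zero (x : E.Path) {y : E.Path} {h : x.range = y.source}
    (hy : y.length = 0) : x.comp y h = x :=
  ext' rfl ((congrArg (x.edges ++ ·) (List.length_eq_zero_iff.1 hy)).trans (List.append_nil _))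

theorem eq_ofVertex_of_length_eq_zero {x : E.Path} (h : x.length = 0) :
    x = ofVertex x.source := ext' rfl (List.length_eq_zero_iff.1 h)

theorem range_eq_source_of_length_eq_zero {x : E.Path} (h : x.length = 0) :
    x.range = x.source := by
  rw [eq_ofVertex_of_length_eq_zero h]; rfl

theorem eq_cons_of_length_pos {x : E.Path} (h : 0 < x.length) :
    ∃ e y, ∃ h : E.r e = y.source, x = cons e y h := by
  induction x using cons_induction with
  | ofVertex a => exact absurd h (lt_irrefl 0)
  | cons e x h' _ => exact ⟨e, x, h', rfl⟩

end Path

/-! ### Presentation of the graph inverse semigroup -/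

namespace GraphInverseSemigroup

variable {E : DirectedGraph.{u, v}}

theorem mk_eq_mk_of_rel {a b : E.FreeSemigroupWithZero} (h : E.DefiningRel a b) : mk a = mk b :=
  (Con.eq _).2 (ConGen.Rel.of _ _ h)

theorem vertex_mul_self (a : E.Vertex) : vertex a * vertex a = vertex a :=
  mk_eq_mk_of_rel (.vertex_mul_self a)

theorem vertex_mul_of_ne {a b : E.Vertex} (h : a ≠ b) : vertex a * vertex b = 0 :=
  mk_eq_mk_of_rel (.vertex_mul_of_ne h)

theorem source_mul_edge (e : E.Edge) : vertex (E.s e) * edge e = edge e :=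
  mk_eq_mk_of_rel (.source_mul_edge e)

theorem edge_mul_range (e : E.Edge) : edge e * vertex (E.r e) = edge e :=
  mk_eq_mk_of_rel (.edge_mul_range e)

theorem range_mul_edgeInv (e : E.Edge) : vertex (E.r e) * edgeInv e = edgeInv e :=
  mk_eq_mk_of_rel (.range_mul_edgeInv e)

theorem edgeInv_mul_source (e : E.Edge) : edgeInv e * vertex (E.s e) = edgeInv e :=
  mk_eq_mk_of_rel (.edgeInv_mul_source e)

theorem edgeInv_mul_self (e : E.Edge) : edgeInv e * edge e = vertex (E.r e) :=
  mk_eq_mk_of_rel (.edgeInv_mul_self e)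

theorem edgeInv_mul_of_ne {e f : E.Edge} (h : e ≠ f) : edgeInv e * edge f = 0 :=
  mk_eq_mk_of_rel (.edgeInv_mul_of_ne h)

@[elab_as_elim]
theorem induction_on {P : E.GraphInverseSemigroup → Prop} (w : E.GraphInverseSemigroup)
    (zero : P 0) (vertex : ∀ a, P (vertex a)) (edge : ∀ e, P (edge e))
    (edgeInv : ∀ e, P (edgeInv e)) (mul : ∀ a b, P a → P b → P (a * b)) : P w := by
  refine Con.induction_on (c := E.congruence) w fun x => ?_
  cases x with
  | none => exact zero
  | some x =>
    induction x using FreeSemigroup.recOnMul with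
    | ih1 g =>
      cases g with
      | vertex a => exact vertex a
      | edge e => exact edge e
      | edgeInv e => exact edgeInv e
    | ih2 g x hg hx => exact mul _ _ hg hx

section Lift

variable {T : Type*} [SemigroupWithZero T]

/-- The extension of a map on the generators to the free semigroup with zero. -/
def liftFree (g : E.Generator → T) : E.FreeSemigroupWithZero →ₙ* T where
  toFun
    | 0 => 0
    | (x : FreeSemigroup E.Generator) => FreeSemigroup.lift g x
  map_mul' x y := by
    cases x with
    | none => exact (zero_mul _).symm
    | some x =>
      cases y with
      | none => exact (mul_zero _).symm
      | some y => exact map_mul (FreeSemigroup.lift g) x y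

theorem liftFree_toFree (g : E.Generator → T) (x : E.Generator) :
    liftFree g x.toFree = g x := FreeSemigroup.lift_of g x

/-- The universal property of `S(E)`: a map from the generators to a semigroup with zero that
respects the defining relations extends to `S(E)`. -/
def lift (g : E.Generator → T) (hg : ∀ a b, E.DefiningRel a b → liftFree g a = liftFree g b) :
    E.GraphInverseSemigroup →ₙ* T where
  toFun := Quotient.lift (liftFree g) fun a b h =>
    (show E.congruence ≤ Con.ker (liftFree g) from Con.conGen_le.2 hg) h
  map_mul' x y := by
    induction x, y using Con.induction_on₂ with
    | H x y => exact map_mul (liftFree g) x y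

end Lift

/-! ### Paths as elements of the semigroup -/

theorem path_ofVertex (a : E.Vertex) : path (Path.ofVertex a) = vertex a := rfl

theorem pathInv_ofVertex (a : E.Vertex) : pathInv (Path.ofVertex a) = vertex a := rfl

theorem path_cons (e : E.Edge) (x : E.Path) (h : E.r e = x.source) :
    path (Path.cons e x h) = edge e * path x := by
  have key : ∀ (l : List E.Edge) (b c : E.GraphInverseSemigroup),
      l.foldl (fun w e => w * edge e) (b * c) = b * l.foldl (fun w e => w * edge e) c := by
    intro l
    induction l with
    | nil => exact fun _ _ => rfl
    | cons f l ih => intro b c; simp only [List.foldl_cons, mul_assoc, ih]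
  simp only [path, Path.cons, List.foldl_cons]
  rw [source_mul_edge, ← edge_mul_range, key, edge_mul_range, h]

theorem pathInv_cons (e : E.Edge) (x : E.Path) (h : E.r e = x.source) :
    pathInv (Path.cons e x h) = pathInv x * edgeInv e := by
  have key : ∀ (l : List E.Edge) (b c : E.GraphInverseSemigroup),
      l.foldl (fun w e => edgeInv e * w) (b * c) = l.foldl (fun w e => edgeInv e * w) b * c := by
    intro l
    induction l with
    | nil => exact fun _ _ => rfl
    | cons f l ih => intro b c; simp only [List.foldl_cons, ← mul_assoc, ih]
  simp only [pathInv, Path.cons, List.foldl_cons]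
  rw [edgeInv_mul_source, ← range_mul_edgeInv, key, range_mul_edgeInv, h]

theorem source_mul_path (x : E.Path) : vertex x.source * path x = path x := by
  induction x using Path.cons_induction with
  | ofVertex a => exact vertex_mul_self a
  | cons e x h _ => rw [path_cons, ← mul_assoc]; exact congrArg (· * _) (source_mul_edge e)

theorem pathInv_mul_source (x : E.Path) : pathInv x * vertex x.source = pathInv x := by
  induction x using Path.cons_induction with
  | ofVertex a => exact vertex_mul_self a
  | cons e x h _ => rw [pathInv_cons, mul_assoc]; exact congrArg (_ * ·) (edgeInv_mul_source e)

theorem path_comp (x y : E.Path) (h : x.range = y.source) :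
    path (x.comp y h) = path x * path y := by
  induction x using Path.cons_induction with
  | ofVertex a =>
    obtain rfl : a = y.source := h
    rw [Path.ofVertex_comp, path_ofVertex, source_mul_path]
  | cons e x h' ih =>
    rw [path_cons, mul_assoc, ← ih h]
    exact path_cons e (x.comp y h) h'

theorem pathInv_comp (x y : E.Path) (h : x.range = y.source) :
    pathInv (x.comp y h) = pathInv y * pathInv x := by
  induction x using Path.cons_induction with
  | ofVertex a =>
    obtain rfl : a = y.source := h
    rw [Path.ofVertex_comp, pathInv_ofVertex, pathInv_mul_source]
  | cons e x h' ih =>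
    rw [pathInv_cons, ← mul_assoc, ← ih h]
    exact pathInv_cons e (x.comp y h) h'

theorem path_mul_range (x : E.Path) : path x * vertex x.range = path x := by
  rw [← path_ofVertex, ← path_comp x _ rfl, Path.comp_ofVertex]

theorem range_mul_pathInv (x : E.Path) : vertex x.range * pathInv x = pathInv x := by
  rw [← pathInv_ofVertex, ← pathInv_comp x _ rfl, Path.comp_ofVertex]

theorem pathInv_mul_path (x : E.Path) : pathInv x * path x = vertex x.range := by
  induction x using Path.cons_induction with
  | ofVertex a => exact vertex_mul_self a
  | cons e x h ih =>
    rw [pathInv_cons, path_cons, mul_assoc, ← mul_assoc (edgeInv e), edgeInv_mul_self, h,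
      source_mul_path, ih]
    rfl

/-- `(xy⁻¹)(yz⁻¹) = xz⁻¹` if `r(x) = r(y)`. -/
theorem path_mul_pathInv_mul_path_mul_pathInv {x y : E.Path} (h : x.range = y.range)
    (z : E.Path) : path x * pathInv y * (path y * pathInv z) = path x * pathInv z := by
  rw [mul_assoc, ← mul_assoc (pathInv y), pathInv_mul_path, ← h, ← mul_assoc, path_mul_range]

/-! ### The natural grading -/

theorem zero_mem_component (n : ℤ) : (0 : E.GraphInverseSemigroup) ∈ component E n := Or.inl rfl

theorem mem_component {n : ℤ} {x y : E.Path} (h : x.range = y.range)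
    (hn : (x.length : ℤ) - y.length = n) : path x * pathInv y ∈ component E n :=
  Or.inr ⟨x, y, h, hn, rfl⟩

theorem path_mem_component (x : E.Path) : path x ∈ component E x.length := by
  rw [← path_mul_range, ← pathInv_ofVertex]
  exact mem_component rfl (sub_zero _)

theorem pathInv_mem_component (x : E.Path) : pathInv x ∈ component E (-x.length) := by
  rw [← range_mul_pathInv, ← path_ofVertex]
  exact mem_component rfl (zero_sub _)

theorem vertex_mem_component (a : E.Vertex) : vertex a ∈ component E 0 :=
  path_mem_component (Path.ofVertex a)

theorem path_ofEdge (e : E.Edge) : path (Path.ofEdge e) = edge e :=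
  (path_cons e (Path.ofVertex _) rfl).trans (edge_mul_range e)

theorem pathInv_ofEdge (e : E.Edge) : pathInv (Path.ofEdge e) = edgeInv e :=
  (pathInv_cons e (Path.ofVertex _) rfl).trans (range_mul_edgeInv e)

theorem edge_mem_component (e : E.Edge) : edge e ∈ component E 1 := by
  rw [← path_ofEdge]
  exact path_mem_component _

theorem edgeInv_mem_component (e : E.Edge) : edgeInv e ∈ component E (-1) := by
  rw [← pathInv_ofEdge]
  exact pathInv_mem_component _

theorem vertex_mul_mem_component {n : ℤ} {w : E.GraphInverseSemigroup} (hw : w ∈ component E n)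
    (a : E.Vertex) : vertex a * w ∈ component E n := by
  obtain rfl | ⟨x, y, h, hn, rfl⟩ := hw
  · rw [mul_zero]; exact zero_mem_component n
  · by_cases ha : a = x.source
    · rw [ha, ← mul_assoc, source_mul_path]
      exact mem_component h hn
    · rw [← source_mul_path, mul_assoc, ← mul_assoc, vertex_mul_of_ne ha, zero_mul]
      exact zero_mem_component n

theorem edge_mul_mem_component {n : ℤ} {w : E.GraphInverseSemigroup} (hw : w ∈ component E n)
    (e : E.Edge) : edge e * w ∈ component E (n + 1) := by
  obtain rfl | ⟨x, y, h, hn, rfl⟩ := hw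
  · rw [mul_zero]; exact zero_mem_component _
  · by_cases ha : E.r e = x.source
    · rw [← mul_assoc, ← path_cons e x ha]
      refine mem_component h ?_
      rw [Path.length_cons, ← hn]
      push_cast
      ring
    · rw [← source_mul_path, ← edge_mul_range, mul_assoc, mul_assoc, ← mul_assoc (vertex _),
        vertex_mul_of_ne ha, zero_mul, mul_zero]
      exact zero_mem_component _

theorem edgeInv_mul_mem_component {n : ℤ} {w : E.GraphInverseSemigroup} (hw : w ∈ component E n)
    (e : E.Edge) : edgeInv e * w ∈ component E (n - 1) := by
  obtain rfl | ⟨x, y, h, hn, rfl⟩ := hw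
  · rw [mul_zero]; exact zero_mem_component _
  · induction x using Path.cons_induction with
    | ofVertex a =>
      obtain rfl : a = y.range := h
      rw [path_ofVertex, range_mul_pathInv]
      by_cases ha : y.range = (Path.ofEdge e).source
      · have key := pathInv_comp y (Path.ofEdge e) ha
        rw [pathInv_ofEdge] at key
        rw [← key, ← range_mul_pathInv, ← path_ofVertex]
        refine mem_component rfl ?_
        have hl' : (Path.ofEdge e).length = 1 := rfl
        rw [← hn, Path.length_comp, hl', Path.length_ofVertex, Path.length_ofVertex]
        push_cast
        ring
      · rw [← range_mul_pathInv, ← edgeInv_mul_source, mul_assoc, ← mul_assoc (vertex _),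
          vertex_mul_of_ne (a := E.s e) (Ne.symm ha), zero_mul, mul_zero]
        exact zero_mem_component _
    | cons f x h' _ =>
      rw [path_cons, ← mul_assoc, ← mul_assoc]
      by_cases hf : e = f
      · rw [hf, edgeInv_mul_self, h', source_mul_path]
        refine mem_component h ?_
        rw [← hn, Path.length_cons]
        push_cast
        ring
      · rw [edgeInv_mul_of_ne hf, zero_mul, zero_mul]
        exact zero_mem_component _

theorem path_mul_mem_component {n : ℤ} {w : E.GraphInverseSemigroup} (hw : w ∈ component E n)
    (x : E.Path) : path x * w ∈ component E (x.length + n) := by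
  induction x using Path.cons_induction with
  | ofVertex a => simpa [path_ofVertex, pathInv_ofVertex] using vertex_mul_mem_component hw a
  | cons e x h ih =>
    rw [path_cons, mul_assoc, Path.length_cons]
    convert edge_mul_mem_component ih e using 2
    push_cast
    ring

theorem pathInv_mul_mem_component {n : ℤ} {w : E.GraphInverseSemigroup}
    (hw : w ∈ component E n) (x : E.Path) : pathInv x * w ∈ component E (n - x.length) := by
  induction x using Path.cons_induction generalizing n w with
  | ofVertex a => simpa [path_ofVertex, pathInv_ofVertex] using vertex_mul_mem_component hw a
  | cons e x h ih =>
    rw [pathInv_cons, mul_assoc, Path.length_cons]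
    convert ih (edgeInv_mul_mem_component hw e) using 2
    push_cast
    ring

theorem mul_mem_component {m n : ℤ} {a b : E.GraphInverseSemigroup} (ha : a ∈ component E m)
    (hb : b ∈ component E n) : a * b ∈ component E (m + n) := by
  obtain rfl | ⟨x, y, h, rfl, rfl⟩ := ha
  · rw [zero_mul]; exact zero_mem_component _
  · rw [mul_assoc]
    convert path_mul_mem_component (pathInv_mul_mem_component hb y) x using 2
    ring

theorem exists_mem_component (w : E.GraphInverseSemigroup) : ∃ n, w ∈ component E n := by
  induction w using induction_on with
  | zero => exact ⟨0, zero_mem_component 0⟩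
  | vertex a => exact ⟨0, vertex_mem_component a⟩
  | edge e => exact ⟨1, edge_mem_component e⟩
  | edgeInv e => exact ⟨-1, edgeInv_mem_component e⟩
  | mul a b ha hb =>
    obtain ⟨m, ha⟩ := ha
    obtain ⟨n, hb⟩ := hb
    exact ⟨m + n, mul_mem_component ha hb⟩

/-- Every nonzero element of `S(E)` is of the form `xy⁻¹`. -/
theorem eq_zero_or_eq_path_mul_pathInv (w : E.GraphInverseSemigroup) :
    w = 0 ∨ ∃ x y : E.Path, x.range = y.range ∧ w = path x * pathInv y := by
  obtain ⟨n, rfl | ⟨x, y, h, -, hw⟩⟩ := exists_mem_component w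
  · exact Or.inl rfl
  · exact Or.inr ⟨x, y, h, hw⟩

end GraphInverseSemigroup

end DirectedGraph

end GraphGrading

/-! ### Actions by partial bijections and the normal form -/

namespace GraphGrading

/-- The symmetric inverse monoid of partial bijections of `X`, as a semigroup with zero. The
product `f * g` is the composite that applies `g` before `f`. -/
instance partialBijectionSemigroup {X : Type*} : SemigroupWithZero (X ≃. X) where
  mul f g := g.trans f
  mul_assoc f g h := (PEquiv.trans_assoc h g f).symm
  zero := ⊥
  zero_mul f := PEquiv.trans_bot f
  mul_zero f := PEquiv.bot_trans f

namespace DirectedGraph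

/-- A set `X` on which the graph `E` acts by prepending edges: every `x : X` has a source, an edge
that ends at this source can be prepended to `x`, and the result determines both the edge
and `x`. -/
structure BranchingSystem (E : DirectedGraph.{u, v}) (X : Type*) where
  /-- the source of a point -/
  source : X → E.Vertex
  /-- the point `ex`, for an edge `e` with `r(e) = s(x)` -/
  cons : ∀ (e : E.Edge) (x : X), E.r e = source x → X
  source_cons : ∀ e x h, source (cons e x h) = E.s e
  cons_inj : ∀ {e f x y h h'}, cons e x h = cons f y h' → e = f ∧ x = y

namespace BranchingSystem

open GraphInverseSemigroup

variable {E : DirectedGraph.{u, v}} {X : Type*} (B : E.BranchingSystem X)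

open Classical in
/-- The partial bijection `x ↦ ex`. -/
noncomputable def edgeMap (e : E.Edge) : X ≃. X where
  toFun x := if h : E.r e = B.source x then some (B.cons e x h) else none
  invFun y := if h : ∃ x h, y = B.cons e x h then some h.choose else none
  inv x y := by
    constructor
    · intro h
      by_cases hy : ∃ x h, y = B.cons e x h
      · rw [dif_pos hy] at h
        obtain rfl := Option.mem_some_iff.1 h
        obtain ⟨hx, hyx⟩ := hy.choose_spec
        rw [dif_pos hx]
        exact congrArg some hyx.symm
      · rw [dif_neg hy] at h
        cases h
    · intro h
      by_cases hx : E.r e = B.source x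
      · rw [dif_pos hx] at h
        obtain rfl := Option.mem_some_iff.1 h
        have hy : ∃ x' h, B.cons e x hx = B.cons e x' h := ⟨x, hx, rfl⟩
        rw [dif_pos hy]
        obtain ⟨hx', hyx⟩ := hy.choose_spec
        exact congrArg some (B.cons_inj hyx).2.symm
      · rw [dif_neg hx] at h
        cases h

open Classical in
/-- The partial bijections by which the generators of `S(E)` act. -/
noncomputable def generatorMap : E.Generator → X ≃. X
  | .vertex a => PEquiv.ofSet {x | B.source x = a}
  | .edge e => B.edgeMap e
  | .edgeInv e => (B.edgeMap e).symm

theorem mul_eq_some {f g : X ≃. X} {x z : X} :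
    (f * g) x = some z ↔ ∃ y, g x = some y ∧ f y = some z :=
  PEquiv.trans_eq_some g f x z

theorem generatorMap_vertex {a : E.Vertex} {x y : X} :
    B.generatorMap (.vertex a) x = some y ↔ x = y ∧ B.source x = a := by
  simp only [generatorMap, PEquiv.ofSet_eq_some_iff, Set.mem_ofPred_eq]
  constructor
  · rintro ⟨rfl, h⟩; exact ⟨rfl, h⟩
  · rintro ⟨rfl, h⟩; exact ⟨rfl, h⟩

theorem generatorMap_edge {e : E.Edge} {x y : X} :
    B.generatorMap (.edge e) x = some y ↔ ∃ h, B.cons e x h = y := by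
  classical
  change (if h : E.r e = B.source x then some (B.cons e x h) else none) = some y ↔ _
  split_ifs with h
  · simp [h]
  · simp [h]

theorem generatorMap_edgeInv {e : E.Edge} {x y : X} :
    B.generatorMap (.edgeInv e) x = some y ↔ ∃ h, B.cons e y h = x :=
  (PEquiv.eq_some_iff _).trans B.generatorMap_edge

theorem generatorMap_rel {a b : E.FreeSemigroupWithZero} (h : E.DefiningRel a b) :
    liftFree B.generatorMap a = liftFree B.generatorMap b := by
  refine PEquiv.ext fun x => Option.ext fun z => ?_
  have h0 : liftFree B.generatorMap 0 x = none := rfl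
  cases h <;> simp only [map_mul, liftFree_toFree, h0, mul_eq_some, generatorMap_vertex,
    generatorMap_edge, generatorMap_edgeInv, reduceCtorEq, iff_false]
  case vertex_mul_self a =>
    constructor
    · rintro ⟨y, ⟨rfl, h⟩, rfl, -⟩; exact ⟨rfl, h⟩
    · rintro ⟨rfl, h⟩; exact ⟨x, ⟨rfl, h⟩, rfl, h⟩
  case vertex_mul_of_ne a b hab =>
    rintro ⟨y, ⟨rfl, h⟩, rfl, h'⟩; exact hab (h'.symm.trans h)
  case source_mul_edge e =>
    constructor
    · rintro ⟨y, ⟨h, rfl⟩, rfl, -⟩; exact ⟨h, rfl⟩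
    · rintro ⟨h, rfl⟩; exact ⟨_, ⟨h, rfl⟩, rfl, B.source_cons _ _ _⟩
  case edge_mul_range e =>
    constructor
    · rintro ⟨y, ⟨rfl, -⟩, h, rfl⟩; exact ⟨h, rfl⟩
    · rintro ⟨h, rfl⟩; exact ⟨x, ⟨rfl, h.symm⟩, h, rfl⟩
  case range_mul_edgeInv e =>
    constructor
    · rintro ⟨y, ⟨h, rfl⟩, rfl, -⟩; exact ⟨h, rfl⟩
    · rintro ⟨h, rfl⟩; exact ⟨_, ⟨h, rfl⟩, rfl, h.symm⟩
  case edgeInv_mul_source e =>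
    constructor
    · rintro ⟨y, ⟨rfl, -⟩, h, rfl⟩; exact ⟨h, rfl⟩
    · rintro ⟨h, rfl⟩; exact ⟨_, ⟨rfl, B.source_cons _ _ _⟩, h, rfl⟩
  case edgeInv_mul_self e =>
    constructor
    · rintro ⟨y, ⟨h, rfl⟩, h', h2⟩; exact ⟨(B.cons_inj h2).2.symm, h.symm⟩
    · rintro ⟨rfl, h⟩; exact ⟨_, ⟨h.symm, rfl⟩, h.symm, rfl⟩
  case edgeInv_mul_of_ne e f hef =>
    rintro ⟨y, ⟨h, rfl⟩, h', h2⟩; exact hef (B.cons_inj h2).1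

/-- The action of `S(E)` on `X` by partial bijections. -/
noncomputable def act : E.GraphInverseSemigroup →ₙ* (X ≃. X) :=
  lift B.generatorMap fun _ _ => B.generatorMap_rel

theorem act_zero (x : X) : B.act 0 x = none := rfl

theorem act_mul_eq_some {a b : E.GraphInverseSemigroup} {x z : X} :
    B.act (a * b) x = some z ↔ ∃ y, B.act b x = some y ∧ B.act a y = some z := by
  rw [map_mul, mul_eq_some]

theorem act_vertex {a : E.Vertex} {x y : X} :
    B.act (vertex a) x = some y ↔ x = y ∧ B.source x = a := B.generatorMap_vertex

theorem act_edge {e : E.Edge} {x y : X} :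
    B.act (edge e) x = some y ↔ ∃ h, B.cons e x h = y := B.generatorMap_edge

theorem act_edgeInv {e : E.Edge} {x y : X} :
    B.act (edgeInv e) x = some y ↔ ∃ h, B.cons e y h = x := B.generatorMap_edgeInv

/-- `p⁻¹` acts as the inverse of the partial bijection by which `p` acts. -/
theorem act_pathInv {p : E.Path} {x y : X} :
    B.act (pathInv p) x = some y ↔ B.act (path p) y = some x := by
  induction p using Path.cons_induction generalizing x with
  | ofVertex a =>
    simp only [path_ofVertex, pathInv_ofVertex, act_vertex]
    constructor
    · rintro ⟨rfl, h⟩; exact ⟨rfl, h⟩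
    · rintro ⟨rfl, h⟩; exact ⟨rfl, h⟩
  | cons e p h ih =>
    simp only [path_cons, pathInv_cons, act_mul_eq_some, ih, act_edge, act_edgeInv]
    exact exists_congr fun _ => and_comm

end BranchingSystem

open GraphInverseSemigroup

/-- The finite paths form a branching system. -/
def pathSystem (E : DirectedGraph.{u, v}) : E.BranchingSystem E.Path where
  source := Path.source
  cons := Path.cons
  source_cons _ _ _ := rfl
  cons_inj {e f x y hx hy} h := by
    have h' := congrArg Path.edges h
    have h'' := List.cons.inj h'
    refine ⟨h''.1, ?_⟩
    obtain rfl := h''.1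
    exact Path.ext' (hx.symm.trans hy) h''.2

/-- The boundary paths form a branching system. -/
def boundarySystem (E : DirectedGraph.{u, v}) : E.BranchingSystem E.BoundaryPath where
  source := BoundaryPath.source
  cons e z h := BoundaryPath.prepend (Path.ofEdge e) z h
  source_cons e z h := BoundaryPath.source_prepend (Path.ofEdge e) z h
  cons_inj {e f x y h h'} heq := by
    obtain ⟨t, h₁, h₂, hf, hx⟩ := BoundaryPath.prepend_eq_prepend heq le_rfl
    have h2 := congrArg Path.edges hf
    obtain ⟨hfe, ht⟩ := List.cons.inj h2
    have ht' : t = Path.ofVertex y.source :=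
      Path.ext' (h₂ ▸ (Path.range_eq_source_of_length_eq_zero
        (congrArg List.length ht.symm)).symm) ht.symm
    subst ht'
    exact ⟨hfe.symm, hx.trans (BoundaryPath.prepend_ofVertex y)⟩

theorem pathSystem_act_path {E : DirectedGraph.{u, v}} {x y z : E.Path} :
    E.pathSystem.act (path x) y = some z ↔ ∃ h, x.comp y h = z := by
  induction x using Path.cons_induction generalizing z with
  | ofVertex a =>
    rw [path_ofVertex, BranchingSystem.act_vertex]
    constructor
    · rintro ⟨rfl, h⟩; exact ⟨h.symm, Path.ofVertex_comp _ _⟩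
    · rintro ⟨h, rfl⟩; exact ⟨(Path.ofVertex_comp _ _).symm, h.symm⟩
  | cons e x h ih =>
    simp only [path_cons, BranchingSystem.act_mul_eq_some, ih, BranchingSystem.act_edge]
    constructor
    · rintro ⟨_, ⟨h₁, rfl⟩, h₂, rfl⟩; exact ⟨h₁, rfl⟩
    · rintro ⟨h₁, rfl⟩; exact ⟨_, ⟨h₁, rfl⟩, h, rfl⟩

theorem boundarySystem_act_path {E : DirectedGraph.{u, v}} {x : E.Path} {y z : E.BoundaryPath} :
    E.boundarySystem.act (path x) y = some z ↔ ∃ h, BoundaryPath.prepend x y h = z := by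
  induction x using Path.cons_induction generalizing z with
  | ofVertex a =>
    rw [path_ofVertex, BranchingSystem.act_vertex]
    constructor
    · rintro ⟨rfl, h⟩
      obtain rfl : y.source = a := h
      exact ⟨rfl, BoundaryPath.prepend_ofVertex _⟩
    · rintro ⟨h, rfl⟩
      obtain rfl : a = y.source := h
      exact ⟨(BoundaryPath.prepend_ofVertex _).symm, rfl⟩
  | cons e x h ih =>
    simp only [path_cons, BranchingSystem.act_mul_eq_some, ih, BranchingSystem.act_edge]
    constructor
    · rintro ⟨_, ⟨h₁, rfl⟩, h₂, rfl⟩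
      exact ⟨h₁, BoundaryPath.prepend_comp (Path.ofEdge e) x y h h₁⟩
    · rintro ⟨h₁, rfl⟩
      exact ⟨_, ⟨h₁, rfl⟩, h.trans (BoundaryPath.source_prepend x y h₁).symm,
        (BoundaryPath.prepend_comp (Path.ofEdge e) x y h h₁).symm⟩

namespace GraphInverseSemigroup

variable {E : DirectedGraph.{u, v}}

/-- `xy⁻¹` maps `yt` to `xt`, and is not defined elsewhere. -/
theorem pathSystem_act_path_mul_pathInv {x y p q : E.Path} :
    E.pathSystem.act (path x * pathInv y) p = some q ↔
      ∃ t h h', y.comp t h = p ∧ x.comp t h' = q := by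
  simp only [BranchingSystem.act_mul_eq_some, BranchingSystem.act_pathInv, pathSystem_act_path]
  constructor
  · rintro ⟨t, ⟨h, rfl⟩, h', rfl⟩; exact ⟨t, h, h', rfl, rfl⟩
  · rintro ⟨t, h, h', rfl, rfl⟩; exact ⟨t, ⟨h, rfl⟩, h', rfl⟩

theorem boundarySystem_act_path_mul_pathInv {x y : E.Path} {p q : E.BoundaryPath} :
    E.boundarySystem.act (path x * pathInv y) p = some q ↔
      ∃ t h h', BoundaryPath.prepend y t h = p ∧ BoundaryPath.prepend x t h' = q := by
  simp only [BranchingSystem.act_mul_eq_some, BranchingSystem.act_pathInv, boundarySystem_act_path]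
  constructor
  · rintro ⟨t, ⟨h, rfl⟩, h', rfl⟩; exact ⟨t, h, h', rfl, rfl⟩
  · rintro ⟨t, h, h', rfl, rfl⟩; exact ⟨t, ⟨h, rfl⟩, h', rfl⟩

theorem act_path_mul_pathInv_self {x y : E.Path} (h : x.range = y.range) :
    E.pathSystem.act (path x * pathInv y) y = some x :=
  pathSystem_act_path_mul_pathInv.2 ⟨Path.ofVertex y.range, rfl, h, Path.comp_ofVertex _ _,
    Path.comp_ofVertex _ _⟩

theorem path_mul_pathInv_ne_zero {x y : E.Path} (h : x.range = y.range) :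
    path x * pathInv y ≠ 0 := fun h0 => by
  have key := act_path_mul_pathInv_self h
  rw [h0, BranchingSystem.act_zero] at key
  cases key

theorem vertex_ne_zero (a : E.Vertex) : vertex a ≠ 0 := by
  have h := path_mul_pathInv_ne_zero (x := Path.ofVertex a) (y := Path.ofVertex a) rfl
  rwa [path_ofVertex, pathInv_ofVertex, vertex_mul_self] at h

/-- The representation of a nonzero element of `S(E)` as `xy⁻¹` is unique. -/
theorem path_mul_pathInv_inj {x y x' y' : E.Path} (h : x.range = y.range)
    (h' : x'.range = y'.range) (heq : path x * pathInv y = path x' * pathInv y') :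
    x = x' ∧ y = y' := by
  have h1 := act_path_mul_pathInv_self h
  have h2 := act_path_mul_pathInv_self h'
  rw [heq, pathSystem_act_path_mul_pathInv] at h1
  rw [← heq, pathSystem_act_path_mul_pathInv] at h2
  obtain ⟨t, ht, ht', hy, hx⟩ := h1
  obtain ⟨s, hs, hs', hy', hx'⟩ := h2
  have hl := congrArg Path.length hy
  have hl' := congrArg Path.length hy'
  rw [Path.length_comp] at hl hl'
  have h0 : t.length = 0 := by omega
  rw [← hx, ← hy]
  exact ⟨Path.comp_of_length_eq_zero _ h0, Path.comp_of_length_eq_zero _ h0⟩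

/-- The nonzero parts of the components of `S(E)` are disjoint. -/
theorem component_disjoint {m n : ℤ} {w : E.GraphInverseSemigroup} (hm : w ∈ component E m)
    (hn : w ∈ component E n) (hw : w ≠ 0) : m = n := by
  obtain rfl | ⟨x, y, h, rfl, rfl⟩ := hm
  · exact absurd rfl hw
  obtain h0 | ⟨x', y', h', rfl, heq⟩ := hn
  · exact absurd h0 hw
  obtain ⟨rfl, rfl⟩ := path_mul_pathInv_inj h h' heq
  rfl

end GraphInverseSemigroup

end DirectedGraph

end GraphGrading

/-! ### Infinite paths and shifts in the boundary path groupoid -/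

namespace GraphGrading

open CategoryTheory

namespace DirectedGraph

variable {E : DirectedGraph.{u, v}}

theorem IsWalk.exists_of_append {c : E.Vertex} {l' : List E.Edge} :
    ∀ {l : List E.Edge} {a : E.Vertex}, E.IsWalk a (l ++ l') c → ∃ b, E.IsWalk a l b
  | [], a, _ => ⟨a, rfl⟩
  | _ :: _, _, h => (exists_of_append h.2).imp fun _ hb => ⟨h.1, hb⟩

namespace InfinitePath

theorem source_prepend (x : E.Path) (p : E.InfinitePath) (h : x.range = p.source) :
    (prepend x p h).source = x.source :=
  (p.chain_append (h ▸ x.isWalk)).1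

theorem exists_eq_prepend (n : ℕ) (p : E.InfinitePath) :
    ∃ x q, ∃ h : x.range = q.source, p = prepend x q h ∧ x.length = n := by
  induction n generalizing p with
  | zero => exact ⟨Path.ofVertex p.source, p, rfl, rfl, rfl⟩
  | succ n ih =>
    obtain ⟨x, q, h, hp, rfl⟩ := ih ⟨p.edges.tail, fun n => p.chain (n + 1)⟩
    have hx : E.r (p.edges.get 0) = x.source := by
      rw [← source_prepend x q h, ← hp]
      exact p.chain 0
    refine ⟨Path.cons _ x hx, q, h, ?_, rfl⟩
    have he := congrArg InfinitePath.edges hp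
    obtain ⟨l, hl⟩ := p
    refine (InfinitePath.mk.injEq _ _ _ _).mpr ?_
    exact (Stream'.eta l).symm.trans (congrArg (Stream'.cons (l.get 0)) he)

/-- A sequence of edges all of whose initial segments are walks from `a` is an infinite path. -/
theorem exists_of_forall_isWalk_take {l : Stream' E.Edge} {a : E.Vertex}
    (H : ∀ n, ∃ b, E.IsWalk a (l.take n) b) :
    ∃ p : E.InfinitePath, ∀ x : E.Path, x.source = a → x.edges = l.take x.length →
      IsInitial x p := by
  have hs : ∀ {n b}, E.IsWalk a (l.take n) b → E.s (l.get n) = b := by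
    intro n b hb
    obtain ⟨c, hc⟩ := H (n + 1)
    rw [Stream'.take_succ'] at hc
    exact (hb.of_append hc).1
  have hl : ∀ n, E.r (l.get n) = E.s (l.get (n + 1)) := by
    intro n
    obtain ⟨b, hb⟩ := H n
    obtain ⟨c, hc⟩ := H (n + 1)
    rw [hs hc]
    rw [Stream'.take_succ'] at hc
    exact (hb.of_append hc).2
  refine ⟨⟨l, hl⟩, fun x hx hxl => ?_⟩
  refine ⟨⟨l.drop x.length, fun n => ?_⟩, ?_, ?_⟩
  · rw [Stream'.get_drop, Stream'.get_drop]
    exact hl _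
  · refine (Eq.trans ?_ (hs (n := x.length) (b := x.range) ?_)).symm
    · exact congrArg E.s (Stream'.get_drop _ _ _)
    · rw [← hx, ← hxl]
      exact x.isWalk
  · refine (InfinitePath.mk.injEq _ _ _ _).mpr ?_
    rw [hxl]
    exact (Stream'.append_take_drop x.length l).symm

theorem IsInitial.of_comp {x t : E.Path} {h : x.range = t.source} {p : E.InfinitePath}
    (hp : IsInitial (x.comp t h) p) : IsInitial x p := by
  obtain ⟨q, hq, rfl⟩ := hp
  exact ⟨prepend t q hq, h.trans (source_prepend t q hq).symm,
    BoundaryPath.infinite.inj (BoundaryPath.prepend_comp x t (.infinite q) h hq)⟩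

/-- Of two initial subpaths of an infinite path, the longer one extends the shorter one. -/
theorem IsInitial.exists_comp {x y : E.Path} {p : E.InfinitePath} (hx : IsInitial x p)
    (hy : IsInitial y p) (hl : x.length ≤ y.length) :
    ∃ t, ∃ h : x.range = t.source, y = x.comp t h := by
  obtain ⟨q, hq, rfl⟩ := hx
  obtain ⟨r, hr, hqr⟩ := hy
  obtain ⟨t, h₁, -, h₂, -⟩ := BoundaryPath.prepend_eq_prepend (z := .infinite q)
    (w := .infinite r) (hx := hq) (hy := hr) (congrArg BoundaryPath.infinite hqr) hl
  exact ⟨t, h₁, h₂⟩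

theorem le_length_of_chain {x : ℕ → E.Path}
    (hx : ∀ k, ∃ t, ∃ h : (x k).range = t.source, x (k + 1) = (x k).comp t h ∧ 0 < t.length)
    (k : ℕ) : k ≤ (x k).length := by
  induction k with
  | zero => exact Nat.zero_le _
  | succ k ih =>
    obtain ⟨t, h, hk, ht⟩ := hx k
    rw [hk, Path.length_comp]
    omega

/-- If every path with the property `P` has a proper extension with the property `P`, then there is
an infinite chain of such extensions. -/
theorem exists_chain {P : E.Path → Prop} {x₀ : E.Path} (h₀ : P x₀)
    (step : ∀ x, P x → ∃ t, ∃ h : x.range = t.source, P (x.comp t h) ∧ 0 < t.length) :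
    ∃ x : ℕ → E.Path, x 0 = x₀ ∧ (∀ k, P (x k)) ∧
      ∀ k, ∃ t, ∃ h : (x k).range = t.source, x (k + 1) = (x k).comp t h ∧ 0 < t.length := by
  choose t h hP ht using step
  let f : {x // P x} → {x // P x} := fun x => ⟨_, hP x.1 x.2⟩
  refine ⟨fun k => (f^[k] ⟨x₀, h₀⟩).1, rfl, fun k => (f^[k] ⟨x₀, h₀⟩).2, fun k => ?_⟩
  exact ⟨_, h _ (f^[k] ⟨x₀, h₀⟩).2,
    congrArg Subtype.val (Function.iterate_succ_apply' f k ⟨x₀, h₀⟩), ht _ _⟩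

/-- An infinite chain of proper extensions of paths converges to an infinite path. -/
theorem exists_of_chain (x : ℕ → E.Path)
    (hx : ∀ k, ∃ t, ∃ h : (x k).range = t.source, x (k + 1) = (x k).comp t h ∧ 0 < t.length) :
    ∃ p : E.InfinitePath, ∀ k, IsInitial (x k) p := by
  have hlen := le_length_of_chain hx
  have hsrc : ∀ k, (x k).source = (x 0).source := by
    intro k
    induction k with
    | zero => rfl
    | succ k ih =>
      obtain ⟨t, h, hk, ht⟩ := hx k
      rw [hk]
      exact ih
  have hpre : ∀ {j k}, j ≤ k → (x j).edges <+: (x k).edges := by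
    intro j k hjk
    induction hjk with
    | refl => exact List.prefix_rfl
    | step _ ih =>
      rename_i k _
      obtain ⟨t, h, hk, ht⟩ := hx k
      rw [hk]
      exact ih.trans (List.prefix_append _ _)
  let l : Stream' E.Edge := fun n => (x (n + 1)).edges[n]'(hlen (n + 1))
  have hget : ∀ k n (hn : n < (x k).edges.length), (x k).edges[n] = l.get n := by
    intro k n hn
    rcases le_total k (n + 1) with h | h
    · exact (hpre h).getElem hn
    · exact ((hpre h).getElem (hlen (n + 1))).symm
  have htake : ∀ k, (x k).edges = l.take (x k).length := by
    intro k
    refine List.ext_getElem (Stream'.length_take _ _).symm fun n h1 h2 => ?_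
    rw [hget k n h1, Stream'.take_get]
  obtain ⟨p, hp⟩ := exists_of_forall_isWalk_take (l := l) (a := (x 0).source) fun n => by
    have hw := (x n).isWalk
    rw [hsrc, htake, ← Nat.add_sub_of_le (hlen n), Stream'.take_add] at hw
    exact hw.exists_of_append
  exact ⟨p, fun k => hp (x k) (hsrc k) (htake k)⟩

end InfinitePath

namespace BoundaryPath

variable (E) in
/-- The condition that carries the equivalences: for every boundary path `p` and every integer `m`
there is an element `(p, m, c)` of the boundary path groupoid. -/
def AllShifts : Prop := ∀ (p : E.BoundaryPath) (m : ℤ), ∃ c, TailEquiv m p c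

theorem allShifts_of_conditionY (hs : E.NoSinks) (hf : E.RowFinite) (hY : E.ConditionY) :
    AllShifts E := by
  intro p m
  cases p with
  | finite x hx => exact absurd ⟨hs _, hf _⟩ hx
  | infinite p =>
    rcases le_total 0 m with hm | hm
    · obtain ⟨n, rfl⟩ := Int.eq_ofNat_of_zero_le hm
      obtain ⟨x, q, h, rfl, rfl⟩ := p.exists_eq_prepend n
      exact ⟨infinite q, x, Path.ofVertex q.source, infinite q, h, rfl, rfl, rfl, by simp⟩
    · obtain ⟨n, hn⟩ := Int.eq_ofNat_of_zero_le (neg_nonneg.2 hm)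
      obtain ⟨x, y, ⟨q, h, rfl⟩, hr, hl⟩ := hY n p
      exact ⟨_, x, y, infinite q, h, hr.trans h, rfl, rfl, by omega⟩

theorem AllShifts.isRegular (H : AllShifts E) (a : E.Vertex) : E.IsRegular a := by
  by_contra ha
  obtain ⟨c, α, β, z, hα, hβ, h1, -, h2⟩ := H (finite (Path.ofVertex a) ha) 1
  cases z with
  | infinite q => cases h1
  | finite y hy =>
    have hα' : α.range = y.source := hα
    have h3 : α.comp y hα' = Path.ofVertex a := BoundaryPath.finite.inj h1
    have h4 := congrArg Path.length h3
    rw [Path.length_comp, Path.length_ofVertex] at h4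
    omega

theorem AllShifts.conditionY (H : AllShifts E) : E.ConditionY := by
  intro n p
  obtain ⟨c, α, β, z, hα, hβ, h1, -, h2⟩ := H (infinite p) (-n)
  cases z with
  | finite y hy => cases h1
  | infinite q =>
    exact ⟨α, β, ⟨q, hα, (BoundaryPath.infinite.inj h1).symm⟩, hβ.trans hα.symm, by omega⟩

variable (E) in
theorem allShifts_iff : AllShifts E ↔ E.NoSinks ∧ E.RowFinite ∧ E.ConditionY :=
  ⟨fun H => ⟨fun a => (H.isRegular a).1, fun a => (H.isRegular a).2, H.conditionY⟩,
    fun ⟨hs, hf, hY⟩ => allShifts_of_conditionY hs hf hY⟩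

variable (E) in
theorem allShifts_iff_stronglyGradedGroupoid :
    AllShifts E ↔ StronglyGradedGroupoid (grading E) := by
  constructor
  · intro H α β a b f hf
    obtain ⟨c, hc⟩ := H b α.toAdd
    have hf' : f.1 = α.toAdd + β.toAdd := congrArg Multiplicative.toAdd hf
    refine ⟨c, ⟨α.toAdd, hc⟩, ⟨β.toAdd, ?_⟩, rfl, rfl, Subtype.ext hf'.symm⟩
    have key := hc.symm.trans f.2
    rwa [hf', neg_add_cancel_left] at key
  · intro H p m
    obtain ⟨c, g, -, hg, -, -⟩ := H (Multiplicative.ofAdd m) (Multiplicative.ofAdd (-m)) (𝟙 p)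
      (by rw [← ofAdd_add, add_neg_cancel]; rfl)
    have hg' : g.1 = m := congrArg Multiplicative.toAdd hg
    exact ⟨c, hg' ▸ g.2⟩

theorem exists_infinitePath_source_eq (hs : E.NoSinks) (a : E.Vertex) :
    ∃ p : E.InfinitePath, p.source = a := by
  obtain ⟨x, h0, -, hx⟩ := InfinitePath.exists_chain (P := fun _ => True) (x₀ := Path.ofVertex a)
    trivial fun x _ => by
      obtain ⟨e, he⟩ := hs x.range
      exact ⟨Path.ofEdge e, he.symm, trivial, Nat.one_pos⟩
  obtain ⟨p, hp⟩ := InfinitePath.exists_of_chain x hx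
  obtain ⟨q, h, rfl⟩ := hp 0
  exact ⟨_, (InfinitePath.source_prepend (x 0) q h).trans (congrArg Path.source h0)⟩

/-- Under `AllShifts`, some path `α` from `a` has a companion `β` with the same range and
`|α| - |β| = m`. -/
theorem AllShifts.exists_path (H : AllShifts E) (a : E.Vertex) (m : ℤ) :
    ∃ α β : E.Path, α.source = a ∧ α.range = β.range ∧ (α.length : ℤ) - β.length = m := by
  obtain ⟨p, rfl⟩ := exists_infinitePath_source_eq (fun b => (H.isRegular b).1) a
  obtain ⟨c, α, β, z, hα, hβ, h1, -, rfl⟩ := H (infinite p) m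
  refine ⟨α, β, ?_, hα.trans hβ.symm, rfl⟩
  rw [← source_prepend α z hα, h1]
  rfl

end BoundaryPath

end DirectedGraph

end GraphGrading

/-! ### Idempotents and the natural order of the graph inverse semigroup -/

namespace GraphGrading

namespace DirectedGraph

variable {E : DirectedGraph.{u, v}}

namespace GraphInverseSemigroup

theorem path_mul_pathInv_self_mem_idempotents (x : E.Path) :
    path x * pathInv x ∈ Idempotents E.GraphInverseSemigroup :=
  path_mul_pathInv_mul_path_mul_pathInv rfl x

theorem vertex_eq_path_mul_pathInv (a : E.Vertex) :
    vertex a = path (Path.ofVertex a) * pathInv (Path.ofVertex a) :=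
  (vertex_mul_self a).symm

/-- The nonzero idempotents of `S(E)` are the elements `xx⁻¹`. -/
theorem exists_of_mem_idempotents {w : E.GraphInverseSemigroup}
    (hw : w ∈ Idempotents E.GraphInverseSemigroup) (h0 : w ≠ 0) :
    ∃ x : E.Path, w = path x * pathInv x := by
  obtain rfl | ⟨x, y, h, rfl⟩ := eq_zero_or_eq_path_mul_pathInv w
  · exact absurd rfl h0
  have h1 := act_path_mul_pathInv_self h
  -- `w` maps `y` to `x`, and `w² = w` forces it to fix `x`
  have h2 : E.pathSystem.act (path x * pathInv y) x = some x := by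
    obtain ⟨z, hz, hz'⟩ := (BranchingSystem.act_mul_eq_some _).1
      ((congrArg (fun w => E.pathSystem.act w y) hw).trans h1)
    obtain rfl := Option.some.inj (hz.symm.trans h1)
    exact hz'
  obtain ⟨t, ht, ht', hy, hx⟩ := pathSystem_act_path_mul_pathInv.1 h2
  have hl := congrArg Path.length hx
  rw [Path.length_comp] at hl
  obtain rfl : y = x := by
    rw [← hy]
    exact (Path.comp_of_length_eq_zero y (by omega)).symm
  exact ⟨y, rfl⟩

theorem ne_zero_of_natLE {s t : E.GraphInverseSemigroup} (h : NatLE s t) (hs : s ≠ 0) : t ≠ 0 := by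
  rintro rfl
  obtain ⟨u, -, rfl⟩ := h
  exact hs (zero_mul u)

theorem zero_natLE (t : E.GraphInverseSemigroup) : NatLE 0 t :=
  ⟨0, zero_mul 0, (mul_zero t).symm⟩

theorem natLE_comp (x t : E.Path) (h : x.range = t.source) :
    NatLE (path (x.comp t h) * pathInv (x.comp t h)) (path x * pathInv x) := by
  refine ⟨_, path_mul_pathInv_self_mem_idempotents (x.comp t h), ?_⟩
  conv_rhs => rw [path_comp, mul_assoc (path x) (path t), ← mul_assoc,
    mul_assoc _ _ (path x), pathInv_mul_path, path_mul_range, ← mul_assoc, ← path_comp _ _ h]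

/-- If `xx⁻¹` is a multiple `yz⁻¹s`, then `x` extends `y`: it is in the image of `yz⁻¹`. -/
theorem exists_comp_of_eq_mul {x y z : E.Path} {s : E.GraphInverseSemigroup}
    (h : path x * pathInv x = path y * pathInv z * s) : ∃ t h, x = y.comp t h := by
  have h1 := act_path_mul_pathInv_self (x := x) rfl
  rw [h] at h1
  obtain ⟨p, -, hp⟩ := (BranchingSystem.act_mul_eq_some _).1 h1
  obtain ⟨t, -, ht, -, hx⟩ := pathSystem_act_path_mul_pathInv.1 hp
  exact ⟨t, ht, hx.symm⟩

theorem natLE_iff {x y : E.Path} : NatLE (path x * pathInv x) (path y * pathInv y) ↔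
    ∃ t h, x = y.comp t h := by
  constructor
  · rintro ⟨u, -, hu⟩
    exact exists_comp_of_eq_mul hu
  · rintro ⟨t, h, rfl⟩
    exact natLE_comp y t h

theorem path_mul_pathInv_self_inj {x y : E.Path}
    (h : path x * pathInv x = path y * pathInv y) : x = y :=
  (path_mul_pathInv_inj rfl rfl h).1

/-- The maximal idempotents of `S(E)` are the vertices. -/
theorem exists_eq_vertex_of_isMaximalIn [Nonempty E.Vertex] {w : E.GraphInverseSemigroup}
    (hw : IsMaximalIn (Idempotents E.GraphInverseSemigroup) w) : ∃ a, w = vertex a := by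
  by_cases h0 : w = 0
  · obtain ⟨a⟩ := ‹Nonempty E.Vertex›
    exact ⟨a, (hw.2 _ (vertex_mul_self a) (h0 ▸ zero_natLE _)).symm⟩
  · obtain ⟨x, rfl⟩ := exists_of_mem_idempotents hw.1 h0
    refine ⟨x.source, (hw.2 _ (vertex_mul_self _) ?_).symm⟩
    rw [vertex_eq_path_mul_pathInv]
    exact natLE_iff.2 ⟨x, rfl, (Path.ofVertex_comp _ _).symm⟩

theorem isMaximalIn_vertex (a : E.Vertex) :
    IsMaximalIn (Idempotents E.GraphInverseSemigroup) (vertex a) := by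
  refine ⟨vertex_mul_self a, fun w hw h => ?_⟩
  obtain ⟨x, rfl⟩ := exists_of_mem_idempotents hw (ne_zero_of_natLE h (vertex_ne_zero a))
  rw [vertex_eq_path_mul_pathInv] at h ⊢
  obtain ⟨t, ht, h⟩ := natLE_iff.1 h
  have hl := congrArg Path.length h
  rw [Path.length_comp, Path.length_ofVertex] at hl
  rw [h, Path.comp_of_length_eq_zero _ (by omega)]

theorem edge_mul_edgeInv (e : E.Edge) :
    edge e * edgeInv e = path (Path.ofEdge e) * pathInv (Path.ofEdge e) := by
  rw [path_ofEdge, pathInv_ofEdge]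

theorem path_mul_pathInv_natLT {x y t : E.Path} {h : y.range = t.source} (hx : x = y.comp t h)
    (ht : 0 < t.length) : NatLT (path x * pathInv x) (path y * pathInv y) := by
  refine ⟨natLE_iff.2 ⟨t, h, hx⟩, fun heq => ?_⟩
  have hl := congrArg Path.length (hx.symm.trans (path_mul_pathInv_self_inj heq))
  rw [Path.length_comp] at hl
  omega

theorem exists_of_natLT {x y : E.Path} (h : NatLT (path x * pathInv x) (path y * pathInv y)) :
    ∃ t h, x = y.comp t h ∧ 0 < t.length := by
  obtain ⟨t, ht, rfl⟩ := natLE_iff.1 h.1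
  refine ⟨t, ht, rfl, Nat.pos_of_ne_zero fun h0 => h.2 ?_⟩
  rw [Path.comp_of_length_eq_zero _ h0]

theorem isMaximalIn_edge_mul_edgeInv {a : E.Vertex} {e : E.Edge} (he : E.s e = a) :
    IsMaximalIn {w ∈ Idempotents E.GraphInverseSemigroup | NatLT w (vertex a)}
      (edge e * edgeInv e) := by
  subst he
  rw [edge_mul_edgeInv, vertex_eq_path_mul_pathInv]
  refine ⟨⟨path_mul_pathInv_self_mem_idempotents _, path_mul_pathInv_natLT
    (Path.ofVertex_comp (Path.ofEdge e) rfl).symm Nat.one_pos⟩, ?_⟩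
  rintro w ⟨hw, hlt⟩ hle
  obtain ⟨y, rfl⟩ := exists_of_mem_idempotents hw
    (ne_zero_of_natLE hle (path_mul_pathInv_ne_zero rfl))
  obtain ⟨s, hs, hys, hs0⟩ := exists_of_natLT hlt
  obtain ⟨t, ht, hyt⟩ := natLE_iff.1 hle
  have hl := congrArg Path.length hyt
  have hl' := congrArg Path.length hys
  rw [Path.length_comp] at hl hl'
  have h1 : (Path.ofEdge e).length = 1 := rfl
  rw [hyt, Path.comp_of_length_eq_zero _ (by omega)]

/-- Besides the `ee⁻¹` with `s(e) = a`, only `0` can be maximal below the vertex `a`, namely if `a`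
is a sink. -/
theorem eq_zero_or_eq_edge_mul_edgeInv {a : E.Vertex} {w : E.GraphInverseSemigroup}
    (hw : IsMaximalIn {w ∈ Idempotents E.GraphInverseSemigroup | NatLT w (vertex a)} w) :
    w = 0 ∨ ∃ e, E.s e = a ∧ edge e * edgeInv e = w := by
  refine or_iff_not_imp_left.2 fun h0 => ?_
  obtain ⟨⟨hi, hlt⟩, hmax⟩ := hw
  obtain ⟨x, rfl⟩ := exists_of_mem_idempotents hi h0
  rw [vertex_eq_path_mul_pathInv] at hlt
  obtain ⟨t, ht, rfl, hpos⟩ := exists_of_natLT hlt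
  obtain rfl : a = t.source := ht
  rw [Path.ofVertex_comp] at *
  obtain ⟨e, y, he, rfl⟩ := Path.eq_cons_of_length_pos hpos
  refine ⟨e, rfl, ?_⟩
  refine hmax _ (isMaximalIn_edge_mul_edgeInv rfl).1 ?_
  rw [edge_mul_edgeInv]
  exact natLE_iff.2 ⟨y, he, rfl⟩

/-! ### The gradings of the graph inverse semigroup -/

theorem finitelyManyMaximalBelow_of_rowFinite [Nonempty E.Vertex] (hf : E.RowFinite) :
    FinitelyManyMaximalBelow E.GraphInverseSemigroup := by
  intro w hw
  obtain ⟨a, rfl⟩ := exists_eq_vertex_of_isMaximalIn hw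
  refine (((hf a).image fun e => edge e * edgeInv e).insert 0).subset fun w hw => ?_
  obtain h | ⟨e, he, h⟩ := eq_zero_or_eq_edge_mul_edgeInv hw
  · exact Or.inl h
  · exact Or.inr ⟨e, he, h⟩

theorem rowFinite_of_finitelyManyMaximalBelow
    (h : FinitelyManyMaximalBelow E.GraphInverseSemigroup) : E.RowFinite := by
  intro a
  refine Set.Finite.of_injOn (f := fun e => edge e * edgeInv e)
    (fun e he => isMaximalIn_edge_mul_edgeInv he) ?_ (h _ (isMaximalIn_vertex a))
  intro e _ f _ hef
  simp only [edge_mul_edgeInv] at hef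
  exact (List.cons.inj (congrArg Path.edges (path_mul_pathInv_self_inj hef))).1

theorem noSinks_of_locallyStronglyGraded (h : LocallyStronglyGraded (component E)) :
    E.NoSinks := by
  intro a
  obtain ⟨b, hb, c, -, hbc, w, -, hw⟩ := h 1 (-1) (vertex a)
    (by rw [add_neg_cancel]; exact vertex_mem_component a) (vertex_ne_zero a)
  obtain rfl | ⟨x, y, hxy, hl, rfl⟩ := hb
  · exact absurd (zero_mul c) hbc
  obtain h0 | ⟨p, q, hpq, hp⟩ := eq_zero_or_eq_path_mul_pathInv (path x * pathInv y * c)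
  · exact absurd h0 hbc
  -- `bc = pq⁻¹` maps `q` to `p`, so that `p` extends both `a` and `x`, where `|x| ≥ 1`
  have hact := act_path_mul_pathInv_self hpq
  have h1 : p.source = a := by
    rw [← hp, hw, vertex_eq_path_mul_pathInv] at hact
    obtain ⟨r, -, hr⟩ := (BranchingSystem.act_mul_eq_some _).1 hact
    obtain ⟨t, -, ht, -, rfl⟩ := pathSystem_act_path_mul_pathInv.1 hr
    rfl
  rw [← hp] at hact
  obtain ⟨r, -, hr⟩ := (BranchingSystem.act_mul_eq_some _).1 hact
  obtain ⟨t, -, ht, -, rfl⟩ := pathSystem_act_path_mul_pathInv.1 hr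
  obtain ⟨e, z, he, rfl⟩ := Path.eq_cons_of_length_pos (x := x) (by omega)
  exact ⟨e, h1⟩

/-- Condition (Y) for an infinite path is the saturation condition for the chain of its initial
subpaths. -/
theorem conditionY_of_saturatedStronglyGraded
    (h : SaturatedStronglyGraded (component E)) : E.ConditionY := by
  intro n p
  choose x q hxq hp hl using fun k => p.exists_eq_prepend k
  have hi : ∀ k, InfinitePath.IsInitial (x k) p := fun k => ⟨q k, hxq k, hp k⟩
  obtain ⟨k, w, ⟨s, hs, t, hst, rfl⟩, hw, hk⟩ := h (-n) (fun k => path (x k) * pathInv (x k))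
    (fun k => path_mul_pathInv_self_mem_idempotents _)
    (fun k => by
      obtain ⟨t, ht, hxk⟩ := (hi k).exists_comp (hi (k + 1)) (by rw [hl, hl]; exact k.le_succ)
      refine path_mul_pathInv_natLT hxk ?_
      have hlk := congrArg Path.length hxk
      rw [Path.length_comp, hl, hl] at hlk
      omega)
    (by
      rw [Path.eq_ofVertex_of_length_eq_zero (hl 0), ← vertex_eq_path_mul_pathInv]
      exact isMaximalIn_vertex _)
  obtain ⟨r, -, hr⟩ := hk
  obtain rfl | ⟨y, z, hyz, hlen, rfl⟩ := hs
  · rw [zero_mul, zero_mul] at hr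
    exact absurd hr (path_mul_pathInv_ne_zero rfl)
  rw [mul_assoc] at hr
  obtain ⟨t', ht', hxk⟩ := exists_comp_of_eq_mul hr
  have hik := hi k
  rw [hxk] at hik
  exact ⟨y, z, hik.of_comp, hyz.symm, by omega⟩

theorem locallyStronglyGraded_of_allShifts (H : BoundaryPath.AllShifts E) :
    LocallyStronglyGraded (component E) := by
  rintro m n s (rfl | ⟨x, y, h, hl, rfl⟩) h0
  · exact absurd rfl h0
  obtain ⟨z, w, hz, hzw, hlen⟩ := H.exists_path x.range (m - x.length)
  have hxz := path_comp x z hz.symm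
  have hab : path (x.comp z hz.symm) * pathInv w *
      (path w * pathInv (y.comp z (h.symm.trans hz.symm))) =
      path (x.comp z hz.symm) * pathInv (y.comp z (h.symm.trans hz.symm)) :=
    path_mul_pathInv_mul_path_mul_pathInv (x := x.comp z hz.symm) hzw _
  refine ⟨_, mem_component (x := x.comp z hz.symm) (y := w) hzw ?_, _,
    mem_component (x := w) (y := y.comp z (h.symm.trans hz.symm)) hzw.symm ?_, ?_, ?_⟩
  · rw [Path.length_comp]; push_cast; omega
  · rw [Path.length_comp]; push_cast; omega
  · rw [hab]
    exact path_mul_pathInv_ne_zero rfl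
  · refine ⟨_, path_mul_pathInv_self_mem_idempotents (y.comp z (h.symm.trans hz.symm)), ?_⟩
    rw [hab, hxz, path_comp y z, ← mul_assoc, ← mul_assoc, mul_assoc _ _ (path y),
      pathInv_mul_path, congrArg vertex h.symm, path_mul_range]

theorem saturatedStronglyGraded_of_allShifts [Nonempty E.Vertex] (H : BoundaryPath.AllShifts E) :
    SaturatedStronglyGraded (component E) := by
  intro m u hu hlt hmax
  -- the idempotents of the chain are nonzero, because only `0` lies below `0`
  have h0 : ∀ k, u k ≠ 0 := by
    intro k hk
    obtain ⟨⟨w, -, hw⟩, hne⟩ := hlt k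
    rw [hk, zero_mul] at hw
    exact hne (hw.trans hk.symm)
  choose x hx using fun k => exists_of_mem_idempotents (hu k) (h0 k)
  have hchain : ∀ k, ∃ t, ∃ h : (x k).range = t.source,
      x (k + 1) = (x k).comp t h ∧ 0 < t.length := by
    intro k
    have h := hlt k
    rw [hx, hx] at h
    exact exists_of_natLT h
  obtain ⟨p, hp⟩ := InfinitePath.exists_of_chain x hchain
  obtain ⟨c, α, β, z, hα, hβ, h1, -, hm⟩ := H (.infinite p) m
  have hx0 : (x 0).length = 0 := by
    obtain ⟨a, ha⟩ := exists_eq_vertex_of_isMaximalIn hmax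
    rw [hx, vertex_eq_path_mul_pathInv] at ha
    rw [path_mul_pathInv_self_inj ha, Path.length_ofVertex]
  have hαp : InfinitePath.IsInitial α p := by
    cases z with
    | finite y hy => cases h1
    | infinite q => exact ⟨q, hα, (BoundaryPath.infinite.inj h1).symm⟩
  have hαβ := hα.trans hβ.symm
  refine ⟨α.length, path α * pathInv α, ⟨path α * pathInv β, mem_component hαβ hm.symm,
    path β * pathInv α, ⟨?_, ?_⟩, ?_⟩, ?_, ?_⟩
  · simp only [path_mul_pathInv_mul_path_mul_pathInv, hαβ]
  · simp only [path_mul_pathInv_mul_path_mul_pathInv, hαβ]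
  · simp only [path_mul_pathInv_mul_path_mul_pathInv, hαβ]
  · rw [hx]
    exact natLE_iff.2 ((hp 0).exists_comp hαp (by omega))
  · rw [hx]
    exact natLE_iff.2 (hαp.exists_comp (hp _) (InfinitePath.le_length_of_chain hchain _))

theorem allShifts_iff_stronglyGraded [Nonempty E.Vertex] : BoundaryPath.AllShifts E ↔
    FinitelyManyMaximalBelow E.GraphInverseSemigroup ∧ LocallyStronglyGraded (component E) ∧
      SaturatedStronglyGraded (component E) :=
  ⟨fun H => ⟨finitelyManyMaximalBelow_of_rowFinite fun a => (H.isRegular a).2,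
      locallyStronglyGraded_of_allShifts H, saturatedStronglyGraded_of_allShifts H⟩,
    fun ⟨hf, hl, hs⟩ => BoundaryPath.allShifts_of_conditionY (noSinks_of_locallyStronglyGraded hl)
      (rowFinite_of_finitelyManyMaximalBelow hf) (conditionY_of_saturatedStronglyGraded hs)⟩

end GraphInverseSemigroup

end DirectedGraph

end GraphGrading

/-! ### Additive maps on Leavitt path algebras -/

namespace GraphGrading

/-- An additive map that vanishes on a two-sided ideal descends to the quotient. -/
def liftQuotient {R B : Type*} [NonUnitalRing R] [AddCommGroup B] (I : TwoSidedIdeal R) (f : R →+ B)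
    (h : ∀ x ∈ I, f x = 0) : I.ringCon.Quotient →+ B where
  toFun := Quotient.lift f fun a b hab =>
    sub_eq_zero.1 ((map_sub f a b).symm.trans (h _ ((I.rel_iff a b).1 hab)))
  map_zero' := map_zero f
  map_add' := by
    rintro ⟨x⟩ ⟨y⟩
    exact map_add f x y

section Contracted

variable {K : Type*} [Field K] {S : Type*} [SemigroupWithZero S]

theorem exists_eq_single_zero {x : MonoidAlgebra K S} (hx : x ∈ zeroIdeal K S) :
    ∃ k, x = MonoidAlgebra.single 0 k := by
  induction hx using TwoSidedIdeal.span_induction with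
  | mem x hx => exact ⟨1, hx⟩
  | zero => exact ⟨0, (MonoidAlgebra.single_zero _).symm⟩
  | add x y _ _ hx hy =>
    obtain ⟨k, rfl⟩ := hx
    obtain ⟨l, rfl⟩ := hy
    exact ⟨k + l, (MonoidAlgebra.single_add _ _ _).symm⟩
  | neg x _ hx =>
    obtain ⟨k, rfl⟩ := hx
    exact ⟨-k, (map_neg (MonoidAlgebra.singleAddHom (R := K) (0 : S)) k).symm⟩
  | left_absorb a x _ hx =>
    obtain ⟨k, rfl⟩ := hx
    induction a using MonoidAlgebra.induction_linear with
    | zero => exact ⟨0, by rw [zero_mul, MonoidAlgebra.single_zero]⟩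
    | add a b ha hb =>
      obtain ⟨k, hk⟩ := ha
      obtain ⟨l, hl⟩ := hb
      exact ⟨k + l, by rw [add_mul, hk, hl, MonoidAlgebra.single_add]⟩
    | single s l => exact ⟨l * k, by rw [MonoidAlgebra.single_mul_single, mul_zero]⟩
  | right_absorb a x _ hx =>
    obtain ⟨k, rfl⟩ := hx
    induction a using MonoidAlgebra.induction_linear with
    | zero => exact ⟨0, by rw [mul_zero, MonoidAlgebra.single_zero]⟩
    | add a b ha hb =>
      obtain ⟨k, hk⟩ := ha
      obtain ⟨l, hl⟩ := hb
      exact ⟨k + l, by rw [mul_add, hk, hl, MonoidAlgebra.single_add]⟩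
    | single s l => exact ⟨k * l, by rw [MonoidAlgebra.single_mul_single, zero_mul]⟩

theorem contractedSingle_mul (s t : S) (k l : K) :
    contractedSingle K s k * contractedSingle K t l = contractedSingle K (s * t) (k * l) :=
  (map_mul (ContractedSemigroupRing.mk K) _ _).symm.trans
    (congrArg _ (MonoidAlgebra.single_mul_single _ _ _ _))

theorem contractedSingle_add (s : S) (k l : K) :
    contractedSingle K s (k + l) = contractedSingle K s k + contractedSingle K s l :=
  (congrArg _ (MonoidAlgebra.single_add _ _ _)).trans (map_add (ContractedSemigroupRing.mk K) _ _)

theorem contractedSingle_zero_right (s : S) : contractedSingle K s 0 = 0 :=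
  (congrArg _ (MonoidAlgebra.single_zero _)).trans (map_zero (ContractedSemigroupRing.mk K))

theorem contractedSingle_zero_left (k : K) : contractedSingle K (0 : S) k = 0 := by
  have h : contractedSingle K (0 : S) 1 = 0 :=
    Quotient.sound (s := (zeroIdeal K S).ringCon.toSetoid)
      (TwoSidedIdeal.subset_span (s := {MonoidAlgebra.single (0 : S) (1 : K)}) rfl)
  rw [← mul_one k, ← mul_zero (0 : S), ← contractedSingle_mul, h, mul_zero]

@[elab_as_elim]
theorem contracted_induction {P : ContractedSemigroupRing K S → Prop}
    (c : ContractedSemigroupRing K S) (zero : P 0) (add : ∀ a b, P a → P b → P (a + b))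
    (single : ∀ s k, P (contractedSingle K s k)) : P c := by
  obtain ⟨x⟩ := c
  change P (ContractedSemigroupRing.mk K x)
  induction x using MonoidAlgebra.induction_linear with
  | zero => rwa [map_zero]
  | add a b ha hb => rw [map_add]; exact add _ _ ha hb
  | single s k => exact single s k

/-- The additive map on `K[S]` with prescribed values on the elements `ks`. -/
noncomputable def contractedLift {B : Type*} [AddCommGroup B] (f : S → K →+ B) (h : f 0 = 0) :
    ContractedSemigroupRing K S →+ B :=
  liftQuotient (zeroIdeal K S)
    ((Finsupp.liftAddHom f).comp MonoidAlgebra.coeffAddEquiv.toAddMonoidHom) fun x hx => by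
      obtain ⟨k, rfl⟩ := exists_eq_single_zero hx
      refine (Finsupp.liftAddHom_apply_single f 0 k).trans ?_
      rw [h]
      rfl

theorem contractedLift_single {B : Type*} [AddCommGroup B] (f : S → K →+ B) (h : f 0 = 0) (s : S)
    (k : K) : contractedLift f h (contractedSingle K s k) = f s k :=
  Finsupp.liftAddHom_apply_single f s k

end Contracted

namespace DirectedGraph

open GraphInverseSemigroup

variable {E : DirectedGraph.{u, v}} (K : Type w) [Field K]

/-- The element `kw` of `L_K(E)`, for `w ∈ S(E)`, as an additive map in `k`. -/
noncomputable def leavittSingle (w : E.GraphInverseSemigroup) : K →+ E.LeavittPathAlgebra K where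
  toFun k := LeavittPathAlgebra.mk E K (contractedSingle K w k)
  map_zero' := by rw [contractedSingle_zero_right, map_zero]
  map_add' k l := by rw [contractedSingle_add, map_add]

theorem leavittSingle_mul (s t : E.GraphInverseSemigroup) (k l : K) :
    leavittSingle K s k * leavittSingle K t l = leavittSingle K (s * t) (k * l) :=
  (map_mul (LeavittPathAlgebra.mk E K) _ _).symm.trans (congrArg _ (contractedSingle_mul _ _ _ _))

theorem leavittSingle_zero (k : K) : leavittSingle K (0 : E.GraphInverseSemigroup) k = 0 :=
  (congrArg _ (contractedSingle_zero_left k)).trans (map_zero (LeavittPathAlgebra.mk E K))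

variable {K} in
@[elab_as_elim]
theorem leavitt_induction {P : E.LeavittPathAlgebra K → Prop} (c : E.LeavittPathAlgebra K)
    (zero : P 0) (add : ∀ a b, P a → P b → P (a + b)) (single : ∀ w k, P (leavittSingle K w k)) :
    P c := by
  obtain ⟨x⟩ := c
  change P (LeavittPathAlgebra.mk E K x)
  induction x using contracted_induction with
  | zero => rwa [map_zero]
  | add a b ha hb => rw [map_add]; exact add _ _ ha hb
  | single s k => exact single s k

/-- The generator `a - ∑ ee⁻¹` of the Cuntz–Krieger ideal, as a sum over a `Finset`. -/
theorem cuntzKrieger_generator_eq {a : E.Vertex} (ha : E.IsRegular a) :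
    contractedSingle K (vertex a) 1 -
      ∑ᶠ e ∈ {e | E.s e = a}, contractedSingle K (edge e * edgeInv e) 1 =
    contractedSingle K (vertex a) 1 -
      ∑ e ∈ ha.2.toFinset, contractedSingle K (edge e * edgeInv e) 1 := by
  rw [finsum_mem_eq_finite_toFinset_sum _ ha.2]

theorem single_mul_generator_mul_single {a : E.Vertex} (ha : E.IsRegular a)
    (s t : E.GraphInverseSemigroup) (k l : K) :
    contractedSingle K s k * (contractedSingle K (vertex a) 1 -
      ∑ e ∈ ha.2.toFinset, contractedSingle K (edge e * edgeInv e) 1) * contractedSingle K t l =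
    contractedSingle K (s * vertex a * t) (k * l) -
      ∑ e ∈ ha.2.toFinset, contractedSingle K (s * (edge e * edgeInv e) * t) (k * l) := by
  rw [mul_sub, sub_mul, Finset.mul_sum, Finset.sum_mul]
  simp only [contractedSingle_mul, mul_one]

theorem vertex_mul_edge_mul_edgeInv_mul_vertex {a : E.Vertex} {e : E.Edge} (he : E.s e = a) :
    vertex a * (edge e * edgeInv e) * vertex a = edge e * edgeInv e := by
  subst he
  rw [← mul_assoc, source_mul_edge, mul_assoc, edgeInv_mul_source]

/-- The Cuntz–Krieger relation, multiplied by elements of `S(E)` on both sides. -/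
theorem leavittSingle_cuntzKrieger {a : E.Vertex} (ha : E.IsRegular a)
    (s t : E.GraphInverseSemigroup) (k : K) :
    leavittSingle K (s * vertex a * t) k =
      ∑ e ∈ ha.2.toFinset, leavittSingle K (s * (edge e * edgeInv e) * t) k := by
  have h0 : LeavittPathAlgebra.mk E K (contractedSingle K (vertex a) 1 -
      ∑ e ∈ ha.2.toFinset, contractedSingle K (edge e * edgeInv e) 1) = 0 :=
    Quotient.sound (s := (E.cuntzKriegerIdeal K).ringCon.toSetoid)
      (TwoSidedIdeal.subset_span ⟨a, ha, (cuntzKrieger_generator_eq K ha).symm⟩)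
  have h1 := congrArg (LeavittPathAlgebra.mk E K) (single_mul_generator_mul_single K ha s t k 1)
  rw [map_mul, map_mul, h0, mul_zero, zero_mul, map_sub, map_sum, mul_one] at h1
  exact sub_eq_zero.1 h1.symm

variable {K} in
/-- The additive map on `L_K(E)` with prescribed values on the elements `kw`, for values that
satisfy the Cuntz–Krieger relations multiplied by elements of `S(E)` on both sides. -/
noncomputable def leavittLift {B : Type*} [AddCommGroup B] (f : E.GraphInverseSemigroup → K →+ B)
    (h : f 0 = 0) (hf : ∀ (a) (ha : E.IsRegular a) (s t : E.GraphInverseSemigroup) (k : K),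
      f (s * vertex a * t) k = ∑ e ∈ ha.2.toFinset, f (s * (edge e * edgeInv e) * t) k) :
    E.LeavittPathAlgebra K →+ B :=
  liftQuotient (E.cuntzKriegerIdeal K) (contractedLift f h) fun x hx => by
    have key : ∀ {a} (ha : E.IsRegular a) (b c : E.CohnPathAlgebra K),
        contractedLift f h (b * (contractedSingle K (vertex a) 1 -
          ∑ e ∈ ha.2.toFinset, contractedSingle K (edge e * edgeInv e) 1) * c) = 0 := by
      intro a ha b c
      induction b using contracted_induction with
      | zero => rw [zero_mul, zero_mul, map_zero]
      | add b b' hb hb' => rw [add_mul, add_mul, map_add, hb, hb', add_zero]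
      | single s k =>
        induction c using contracted_induction with
        | zero => rw [mul_zero, map_zero]
        | add b b' hb hb' => rw [mul_add, map_add, hb, hb', add_zero]
        | single t l =>
          rw [single_mul_generator_mul_single K ha, map_sub, map_sum, contractedLift_single, hf a ha]
          simp only [contractedLift_single, sub_self]
    -- a generator equals its product with `a` on either side
    have hgen : ∀ {a} (ha : E.IsRegular a),
        contractedSingle K (vertex a) 1 * (contractedSingle K (vertex a) 1 -
          ∑ e ∈ ha.2.toFinset, contractedSingle K (edge e * edgeInv e) 1) *
          contractedSingle K (vertex a) 1 = contractedSingle K (vertex a) 1 -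
          ∑ e ∈ ha.2.toFinset, contractedSingle K (edge e * edgeInv e) 1 := by
      intro a ha
      rw [single_mul_generator_mul_single K ha, vertex_mul_self, vertex_mul_self, mul_one]
      refine congrArg _ (Finset.sum_congr rfl fun e he => ?_)
      rw [vertex_mul_edge_mul_edgeInv_mul_vertex (ha.2.mem_toFinset.1 he)]
    rw [cuntzKriegerIdeal, TwoSidedIdeal.mem_span_iff_mem_addSubgroup_closure_nonunital] at hx
    induction hx using AddSubgroup.closure_induction with
    | zero => exact map_zero _
    | add x y _ _ hx hy => rw [map_add, hx, hy, add_zero]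
    | neg x _ hx => rw [map_neg, hx, neg_zero]
    | mem x hx =>
      obtain ((⟨a, ha, rfl⟩ | ⟨_, ⟨a, ha, rfl⟩, c, -, rfl⟩) | ⟨b, -, _, ⟨a, ha, rfl⟩, rfl⟩) |
        ⟨_, ⟨b, -, _, ⟨a, ha, rfl⟩, rfl⟩, c, -, rfl⟩ := hx
      all_goals simp only [cuntzKrieger_generator_eq K ha]
      · rw [← hgen ha]
        exact key ha _ _
      · rw [← hgen ha, mul_assoc _ _ c]
        exact key ha _ _
      · rw [← hgen ha, ← mul_assoc, ← mul_assoc]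
        exact key ha _ _
      · exact key ha _ _

variable {K} in
theorem leavittLift_single {B : Type*} [AddCommGroup B] {f : E.GraphInverseSemigroup → K →+ B}
    {h : f 0 = 0} {hf : ∀ (a) (ha : E.IsRegular a) (s t : E.GraphInverseSemigroup) (k : K),
      f (s * vertex a * t) k = ∑ e ∈ ha.2.toFinset, f (s * (edge e * edgeInv e) * t) k}
    (w : E.GraphInverseSemigroup) (k : K) :
    leavittLift f h hf (leavittSingle K w k) = f w k :=
  contractedLift_single f h w k

end DirectedGraph

end GraphGrading

namespace GraphGrading

namespace DirectedGraph

open GraphInverseSemigroup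

variable {E : DirectedGraph.{u, v}} (K : Type w) [Field K]

/-! ### The grading of the Leavitt path algebra -/

theorem leavittSingle_mem_component {n : ℤ} {w : E.GraphInverseSemigroup}
    (hw : w ∈ component E n) (k : K) : leavittSingle K w k ∈ E.leavittComponent K n :=
  AddSubgroup.subset_closure ⟨w, hw, k, rfl⟩

open Classical in
/-- The value `kw` or `0` of the projection to the component of degree `n`, according to whether
`w` has degree `n` or not. -/
noncomputable def componentValue (n : ℤ) (w : E.GraphInverseSemigroup) :
    K →+ E.LeavittPathAlgebra K :=
  if w ∈ component E n then leavittSingle K w else 0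

theorem componentValue_of_mem {n : ℤ} {w : E.GraphInverseSemigroup} (hw : w ∈ component E n) :
    componentValue K n w = leavittSingle K w := if_pos hw

theorem componentValue_of_mem_of_ne {m n : ℤ} (hmn : m ≠ n) {w : E.GraphInverseSemigroup}
    (hw : w ∈ component E m) (k : K) : componentValue K n w k = 0 := by
  by_cases h : w ∈ component E n
  · obtain rfl : w = 0 := by_contra fun h0 => hmn (component_disjoint hw h h0)
    rw [componentValue_of_mem K h, leavittSingle_zero]
  · rw [componentValue, if_neg h]
    rfl

/-- The projection of `L_K(E)` to its component of degree `n`. It is well defined since the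
Cuntz–Krieger relations are homogeneous. -/
noncomputable def projection (n : ℤ) : E.LeavittPathAlgebra K →+ E.LeavittPathAlgebra K :=
  leavittLift (componentValue K n)
    (AddMonoidHom.ext fun k => by
      rw [componentValue_of_mem K (zero_mem_component n), leavittSingle_zero]; rfl)
    fun a ha s t k => by
      obtain ⟨i, hi⟩ := exists_mem_component s
      obtain ⟨j, hj⟩ := exists_mem_component t
      have h1 : s * vertex a * t ∈ component E (i + 0 + j) :=
        mul_mem_component (mul_mem_component hi (vertex_mem_component a)) hj
      have h2 : ∀ e : E.Edge, s * (edge e * edgeInv e) * t ∈ component E (i + 0 + j) := fun e =>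
        mul_mem_component (mul_mem_component hi
          (mul_mem_component (edge_mem_component e) (edgeInv_mem_component e))) hj
      by_cases hn : i + 0 + j = n
      · subst hn
        simp only [componentValue_of_mem K h1, componentValue_of_mem K (h2 _),
          leavittSingle_cuntzKrieger K ha]
      · simp only [componentValue_of_mem_of_ne K hn h1, componentValue_of_mem_of_ne K hn (h2 _),
          Finset.sum_const_zero]

theorem projection_apply {m : ℤ} {c : E.LeavittPathAlgebra K} (hc : c ∈ E.leavittComponent K m)
    (n : ℤ) : projection K n c = if m = n then c else 0 := by
  induction hc using AddSubgroup.closure_induction with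
  | zero => simp
  | add x y _ _ hx hy => rw [map_add, hx, hy]; split_ifs <;> simp
  | neg x _ hx => rw [map_neg, hx]; split_ifs <;> simp
  | mem c hc =>
    obtain ⟨w, hw, k, rfl⟩ := hc
    refine (leavittLift_single w k).trans ?_
    split_ifs with h
    · subst h
      rw [componentValue_of_mem K hw]
      rfl
    · exact componentValue_of_mem_of_ne K h hw k

theorem isInternal_leavittComponent : DirectSum.IsInternal (E.leavittComponent K) := by
  constructor
  · have key : ∀ (x : DirectSum ℤ fun i => E.leavittComponent K i) (n : ℤ),
        projection K n (DirectSum.coeAddMonoidHom (E.leavittComponent K) x) = x n := by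
      intro x n
      induction x using DirectSum.induction_on with
      | zero => simp
      | add x y hx hy => rw [map_add, map_add, hx, hy]; rfl
      | of i y =>
        rw [DirectSum.coeAddMonoidHom_of, projection_apply K y.2]
        split_ifs with h
        · subst h
          rw [DirectSum.of_eq_same]
        · rw [DirectSum.of_eq_of_ne _ _ _ (Ne.symm h)]
          rfl
    refine (injective_iff_map_eq_zero _).2 fun x hx => ?_
    ext n
    rw [← key, hx, map_zero]
    rfl
  · intro c
    induction c using leavitt_induction with
    | zero => exact ⟨0, map_zero _⟩
    | add a b ha hb =>
      obtain ⟨x, rfl⟩ := ha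
      obtain ⟨y, rfl⟩ := hb
      exact ⟨x + y, map_add _ _ _⟩
    | single w k =>
      obtain ⟨n, hn⟩ := exists_mem_component w
      exact ⟨DirectSum.of (fun i => E.leavittComponent K i) n
        ⟨_, leavittSingle_mem_component K hn k⟩, DirectSum.coeAddMonoidHom_of _ _ _⟩

variable (E) in
/-- The additive subgroup `L_K(E)_m L_K(E)_n`. -/
noncomputable def componentMul (m n : ℤ) : AddSubgroup (E.LeavittPathAlgebra K) :=
  AddSubgroup.closure {c | ∃ a ∈ E.leavittComponent K m, ∃ b ∈ E.leavittComponent K n, c = a * b}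

theorem mul_mem_leavittComponent {m n : ℤ} {a b : E.LeavittPathAlgebra K}
    (ha : a ∈ E.leavittComponent K m) (hb : b ∈ E.leavittComponent K n) :
    a * b ∈ E.leavittComponent K (m + n) := by
  induction ha using AddSubgroup.closure_induction with
  | zero => rw [zero_mul]; exact zero_mem _
  | add x y _ _ hx hy => rw [add_mul]; exact add_mem hx hy
  | neg x _ hx => rw [neg_mul]; exact neg_mem hx
  | mem a ha =>
    obtain ⟨s, hs, k, rfl⟩ := ha
    induction hb using AddSubgroup.closure_induction with
    | zero => rw [mul_zero]; exact zero_mem _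
    | add x y _ _ hx hy => rw [mul_add]; exact add_mem hx hy
    | neg x _ hx => rw [mul_neg]; exact neg_mem hx
    | mem b hb =>
      obtain ⟨t, ht, l, rfl⟩ := hb
      have h := leavittSingle_mem_component K (mul_mem_component hs ht) (k * l)
      rwa [← leavittSingle_mul] at h

theorem componentMul_le (m n : ℤ) : componentMul E K m n ≤ E.leavittComponent K (m + n) := by
  refine (AddSubgroup.closure_le _).2 ?_
  rintro _ ⟨a, ha, b, hb, rfl⟩
  exact mul_mem_leavittComponent K ha hb

theorem mul_mem_componentMul {m n : ℤ} {c d : E.LeavittPathAlgebra K}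
    (hc : c ∈ componentMul E K m (-m)) (hd : d ∈ E.leavittComponent K (m + n)) :
    c * d ∈ componentMul E K m n := by
  induction hc using AddSubgroup.closure_induction with
  | zero => rw [zero_mul]; exact zero_mem _
  | add x y _ _ hx hy => rw [add_mul]; exact add_mem hx hy
  | neg x _ hx => rw [neg_mul]; exact neg_mem hx
  | mem c hc =>
    obtain ⟨a, ha, b, hb, rfl⟩ := hc
    have h := mul_mem_leavittComponent K hb hd
    rw [neg_add_cancel_left] at h
    exact AddSubgroup.subset_closure ⟨a, ha, b * d, h, mul_assoc _ _ _⟩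

/-- If all shifts exist, then every vertex lies in `L_K(E)_m L_K(E)_{-m}`. Otherwise, by the
Cuntz–Krieger relations and as in König's lemma, there is an infinite path none of whose initial
subpaths `x` satisfies `xx⁻¹ ∈ L_K(E)_m L_K(E)_{-m}`; a shift of this path by `m` contradicts
that. -/
theorem vertex_mem_componentMul (H : BoundaryPath.AllShifts E) (a : E.Vertex) (m : ℤ) :
    leavittSingle K (vertex a) 1 ∈ componentMul E K m (-m) := by
  by_contra ha
  rw [vertex_eq_path_mul_pathInv] at ha
  obtain ⟨x, -, hx, hchain⟩ := InfinitePath.exists_chain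
    (P := fun x => leavittSingle K (path x * pathInv x) 1 ∉ componentMul E K m (-m)) ha
    fun x hx => by
      by_contra! hy
      refine hx ?_
      rw [← path_mul_range, leavittSingle_cuntzKrieger K (H.isRegular x.range)]
      refine sum_mem fun e he => ?_
      have he' : x.range = (Path.ofEdge e).source :=
        (((H.isRegular x.range).2.mem_toFinset).1 he).symm
      by_contra h
      refine absurd (hy (Path.ofEdge e) he' ?_) (not_le.2 Nat.one_pos)
      rw [path_comp, pathInv_comp, path_ofEdge, pathInv_ofEdge]
      simpa only [mul_assoc] using h
  obtain ⟨p, hp⟩ := InfinitePath.exists_of_chain x hchain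
  obtain ⟨c, α, β, z, hα, hβ, h1, -, hm⟩ := H (.infinite p) m
  have hαp : InfinitePath.IsInitial α p := by
    cases z with
    | finite y hy => cases h1
    | infinite q => exact ⟨q, hα, (BoundaryPath.infinite.inj h1).symm⟩
  obtain ⟨t, ht, hxt⟩ := hαp.exists_comp (hp α.length)
    (InfinitePath.le_length_of_chain hchain α.length)
  refine hx α.length ?_
  have hβt : β.range = t.source := hβ.trans (hα.symm.trans ht)
  have hm' : (α.length : ℤ) + t.length - (β.length + t.length) = m := by rw [hm]; ring
  have h2 := path_mul_pathInv_mul_path_mul_pathInv (x := α.comp t ht) (y := β.comp t hβt) rfl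
    (α.comp t ht)
  have h3 : path (α.comp t ht) * pathInv (β.comp t hβt) ∈ component E m :=
    mem_component rfl (by rw [Path.length_comp, Path.length_comp]; push_cast; exact hm')
  have h4 : path (β.comp t hβt) * pathInv (α.comp t ht) ∈ component E (-m) :=
    mem_component rfl (by rw [Path.length_comp, Path.length_comp]; push_cast; rw [← hm']; ring)
  rw [hxt, ← h2, ← mul_one (1 : K), ← leavittSingle_mul]
  exact AddSubgroup.subset_closure ⟨_, leavittSingle_mem_component K h3 1, _,
    leavittSingle_mem_component K h4 1, rfl⟩

theorem stronglyGradedRing_of_allShifts (H : BoundaryPath.AllShifts E) :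
    StronglyGradedRing (E.leavittComponent K) := by
  refine ⟨isInternal_leavittComponent K, fun m n => le_antisymm (componentMul_le K m n) ?_⟩
  refine (AddSubgroup.closure_le _).2 ?_
  rintro _ ⟨w, hw, k, rfl⟩
  change leavittSingle K w k ∈ componentMul E K m n
  have hw' := hw
  obtain rfl | ⟨x, y, -, -, rfl⟩ := hw
  · rw [leavittSingle_zero]
    exact zero_mem _
  · have h := mul_mem_componentMul K (vertex_mem_componentMul K H x.source m)
      (leavittSingle_mem_component K hw' k)
    rwa [leavittSingle_mul, one_mul, ← mul_assoc, source_mul_path] at h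

/-! ### The representation of the Leavitt path algebra on the boundary paths -/

/-- The linear map on the free module over `X` that a partial bijection of `X` induces. -/
noncomputable def linearize {X : Type*} (f : X ≃. X) : Module.End K (X →₀ K) :=
  Finsupp.linearCombination K fun x => (f x).elim 0 fun y => Finsupp.single y 1

theorem linearize_single {X : Type*} (f : X ≃. X) (x : X) :
    linearize K f (Finsupp.single x 1) = (f x).elim 0 fun y => Finsupp.single y 1 := by
  rw [linearize, Finsupp.linearCombination_single, one_smul]

theorem linearize_mul {X : Type*} (f g : X ≃. X) :
    linearize K (f * g) = linearize K f * linearize K g := by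
  refine Finsupp.lhom_ext' fun x => LinearMap.ext_ring ?_
  change linearize K (f * g) (Finsupp.single x 1) =
    linearize K f (linearize K g (Finsupp.single x 1))
  rw [linearize_single, linearize_single]
  change ((g x).bind f).elim _ _ = _
  cases g x with
  | none => exact (map_zero _).symm
  | some y => exact (linearize_single K f y).symm

/-- The operator of `w ∈ S(E)` on the free module over the boundary paths. -/
noncomputable def boundaryOperator (w : E.GraphInverseSemigroup) :
    Module.End K (E.BoundaryPath →₀ K) :=
  linearize K (E.boundarySystem.act w)

theorem boundaryOperator_mul (s t : E.GraphInverseSemigroup) :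
    boundaryOperator K (s * t) = boundaryOperator K s * boundaryOperator K t := by
  rw [boundaryOperator, map_mul, linearize_mul]
  rfl

/-- A boundary path that starts at a regular vertex has a first edge. -/
theorem exists_eq_boundarySystem_cons {z : E.BoundaryPath} (hz : E.IsRegular z.source) :
    ∃ e y h, E.boundarySystem.cons e y h = z := by
  have key : ∃ (x : E.Path) (y : E.BoundaryPath) (h : x.range = y.source), 0 < x.length ∧
      BoundaryPath.prepend x y h = z := by
    cases z with
    | infinite p =>
      obtain ⟨x, q, h, rfl, hx⟩ := p.exists_eq_prepend 1
      exact ⟨x, .infinite q, h, hx ▸ Nat.one_pos, rfl⟩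
    | finite x hx =>
      refine ⟨x, .finite (Path.ofVertex x.range) hx, rfl, Nat.pos_of_ne_zero fun h0 => hx ?_, ?_⟩
      · rw [Path.range_eq_source_of_length_eq_zero h0]
        exact hz
      · simp only [BoundaryPath.prepend, Path.comp_ofVertex]
  obtain ⟨x, y, h, hx, rfl⟩ := key
  obtain ⟨e, x, he, rfl⟩ := Path.eq_cons_of_length_pos hx
  exact ⟨e, BoundaryPath.prepend x y h, he.trans (BoundaryPath.source_prepend x y h).symm,
    (BoundaryPath.prepend_comp (Path.ofEdge e) x y he h).symm⟩

theorem boundaryOperator_cuntzKrieger {a : E.Vertex} (ha : E.IsRegular a) :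
    boundaryOperator K (vertex a) =
      ∑ e ∈ ha.2.toFinset, boundaryOperator K (edge e * edgeInv e) := by
  refine Finsupp.lhom_ext' fun z => LinearMap.ext_ring ?_
  change boundaryOperator K (vertex a) (Finsupp.single z 1) =
    (∑ e ∈ ha.2.toFinset, boundaryOperator K (edge e * edgeInv e)) (Finsupp.single z 1)
  rw [LinearMap.sum_apply]
  simp only [boundaryOperator, linearize_single]
  have hnone : ∀ {e : E.Edge}, (¬ ∃ y h, E.boundarySystem.cons e y h = z) →
      E.boundarySystem.act (edge e * edgeInv e) z = none := by
    intro e he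
    refine Option.eq_none_iff_forall_ne_some.2 fun w hw => he ?_
    obtain ⟨y, hy, -⟩ := (BranchingSystem.act_mul_eq_some _).1 hw
    exact ⟨y, (BranchingSystem.act_edgeInv _).1 hy⟩
  by_cases hz : z.source = a
  · obtain ⟨e, y, h, hcons⟩ := exists_eq_boundarySystem_cons (hz.symm ▸ ha)
    have he : E.s e = a := by
      rw [← hz, ← hcons]
      exact (E.boundarySystem.source_cons e y h).symm
    have h1 : E.boundarySystem.act (vertex a) z = some z :=
      (BranchingSystem.act_vertex _).2 ⟨rfl, hz⟩
    have h2 : E.boundarySystem.act (edge e * edgeInv e) z = some z :=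
      (BranchingSystem.act_mul_eq_some _).2 ⟨y, (BranchingSystem.act_edgeInv _).2 ⟨h, hcons⟩,
        (BranchingSystem.act_edge _).2 ⟨h, hcons⟩⟩
    rw [Finset.sum_eq_single e, h1, h2]
    · intro f _ hfe
      rw [hnone fun ⟨y', h', hcons'⟩ =>
        hfe (E.boundarySystem.cons_inj (hcons'.trans hcons.symm)).1]
      rfl
    · exact fun h => absurd (ha.2.mem_toFinset.2 he) h
  · have h1 : E.boundarySystem.act (vertex a) z = none :=
      Option.eq_none_iff_forall_ne_some.2 fun w hw =>
        hz ((BranchingSystem.act_vertex _).1 hw).2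
    rw [h1, Finset.sum_eq_zero]
    · rfl
    · intro e he
      rw [hnone]
      · rfl
      · rintro ⟨y, h, rfl⟩
        exact hz ((E.boundarySystem.source_cons e y h).trans (ha.2.mem_toFinset.1 he))

/-- The operator of `kw`, for `k ∈ K` and `w ∈ S(E)`, as an additive map in `k`. -/
noncomputable def scaledBoundaryOperator (w : E.GraphInverseSemigroup) :
    K →+ Module.End K (E.BoundaryPath →₀ K) :=
  (smulAddHom K (Module.End K (E.BoundaryPath →₀ K))).flip (boundaryOperator K w)

theorem scaledBoundaryOperator_zero :
    scaledBoundaryOperator K (0 : E.GraphInverseSemigroup) = 0 := by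
  have h : boundaryOperator K (0 : E.GraphInverseSemigroup) = 0 := by
    refine Finsupp.lhom_ext' fun z => LinearMap.ext_ring ?_
    exact linearize_single K _ z
  ext1 k
  change k • boundaryOperator K (0 : E.GraphInverseSemigroup) = 0
  rw [h, smul_zero]

theorem scaledBoundaryOperator_cuntzKrieger {a : E.Vertex} (ha : E.IsRegular a)
    (s t : E.GraphInverseSemigroup) (k : K) :
    scaledBoundaryOperator K (s * vertex a * t) k =
      ∑ e ∈ ha.2.toFinset, scaledBoundaryOperator K (s * (edge e * edgeInv e) * t) k := by
  change k • boundaryOperator K (s * vertex a * t) =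
    ∑ e ∈ ha.2.toFinset, k • boundaryOperator K (s * (edge e * edgeInv e) * t)
  rw [← Finset.smul_sum]
  simp only [boundaryOperator_mul K _ t, boundaryOperator_mul K s]
  rw [← Finset.sum_mul, ← Finset.mul_sum, boundaryOperator_cuntzKrieger K ha]

variable (E) in
/-- The representation of `L_K(E)` on the free module over the boundary paths. -/
noncomputable def boundaryRepresentation :
    E.LeavittPathAlgebra K →+ Module.End K (E.BoundaryPath →₀ K) :=
  leavittLift (B := Module.End K (E.BoundaryPath →₀ K)) (scaledBoundaryOperator K)
    (scaledBoundaryOperator_zero K)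
    fun _ => scaledBoundaryOperator_cuntzKrieger K

theorem boundaryRepresentation_single (w : E.GraphInverseSemigroup) (k : K) :
    boundaryRepresentation E K (leavittSingle K w k) = k • boundaryOperator K w :=
  leavittLift_single w k

theorem boundaryRepresentation_mul (a b : E.LeavittPathAlgebra K) :
    boundaryRepresentation E K (a * b) =
      boundaryRepresentation E K a * boundaryRepresentation E K b := by
  induction a using leavitt_induction with
  | zero => rw [zero_mul, map_zero, zero_mul]
  | add a a' ha ha' => rw [add_mul, map_add, ha, ha', map_add, add_mul]
  | single s k =>
    induction b using leavitt_induction with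
    | zero => rw [mul_zero, map_zero, mul_zero]
    | add b b' hb hb' => rw [mul_add, map_add, hb, hb', map_add, mul_add]
    | single t l =>
      rw [leavittSingle_mul, boundaryRepresentation_single, boundaryRepresentation_single,
        boundaryRepresentation_single, boundaryOperator_mul, smul_mul_smul_comm]

/-- A boundary path that has no shift by `m` is annihilated by `L_K(E)_{-m}`. -/
theorem boundaryRepresentation_eq_zero {p : E.BoundaryPath} {m : ℤ}
    (hp : ¬ ∃ c, BoundaryPath.TailEquiv m p c) {b : E.LeavittPathAlgebra K}
    (hb : b ∈ E.leavittComponent K (-m)) :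
    boundaryRepresentation E K b (Finsupp.single p 1) = 0 := by
  induction hb using AddSubgroup.closure_induction with
  | zero => rw [map_zero]; rfl
  | add x y _ _ hx hy => rw [map_add, LinearMap.add_apply, hx, hy, add_zero]
  | neg x _ hx => rw [map_neg, LinearMap.neg_apply, hx, neg_zero]
  | mem b hb =>
    obtain ⟨w, hw, k, rfl⟩ := hb
    change boundaryRepresentation E K (leavittSingle K w k) _ = 0
    have hnone : E.boundarySystem.act w p = none := by
      refine Option.eq_none_iff_forall_ne_some.2 fun c hc => hp ?_
      obtain rfl | ⟨x, y, -, hl, rfl⟩ := hw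
      · cases hc
      · obtain ⟨t, h, h', hp, hc⟩ := boundarySystem_act_path_mul_pathInv.1 hc
        exact ⟨c, y, x, t, h, h', hp, hc, by omega⟩
    rw [boundaryRepresentation_single, LinearMap.smul_apply, boundaryOperator, linearize_single,
      hnone]
    exact smul_zero k

theorem allShifts_of_stronglyGradedRing (h : StronglyGradedRing (E.leavittComponent K)) :
    BoundaryPath.AllShifts E := by
  intro p m
  by_contra hp
  have hmem : leavittSingle K (vertex p.source) 1 ∈ componentMul E K m (-m) := by
    rw [componentMul, h.2, add_neg_cancel]
    exact leavittSingle_mem_component K (vertex_mem_component _) 1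
  have key : ∀ c ∈ componentMul E K m (-m),
      boundaryRepresentation E K c (Finsupp.single p 1) = 0 := by
    intro c hc
    induction hc using AddSubgroup.closure_induction with
    | zero => rw [map_zero]; rfl
    | add x y _ _ hx hy => rw [map_add, LinearMap.add_apply, hx, hy, add_zero]
    | neg x _ hx => rw [map_neg, LinearMap.neg_apply, hx, neg_zero]
    | mem c hc =>
      obtain ⟨a, -, b, hb, rfl⟩ := hc
      rw [boundaryRepresentation_mul, Module.End.mul_apply,
        boundaryRepresentation_eq_zero K hp hb, map_zero]
  have h0 := key _ hmem
  have hact : E.boundarySystem.act (vertex p.source) p = some p :=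
    (BranchingSystem.act_vertex _).2 ⟨rfl, rfl⟩
  rw [boundaryRepresentation_single, one_smul, boundaryOperator, linearize_single, hact] at h0
  exact one_ne_zero (Finsupp.single_eq_zero.1 h0)

end DirectedGraph

end GraphGrading

theorem corollary7p11 (E : GraphGrading.DirectedGraph.{u, v}) (hE : Nonempty E.Vertex) :
    List.TFAE [
      E.NoSinks ∧ E.RowFinite ∧ E.ConditionY,
      ∀ (K : Type w) [Field K], GraphGrading.StronglyGradedRing (E.leavittComponent K),
      ∃ (K : Type w) (_ : Field K), GraphGrading.StronglyGradedRing (E.leavittComponent K),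
      GraphGrading.StronglyGradedGroupoid (GraphGrading.DirectedGraph.BoundaryPath.grading E),
      GraphGrading.FinitelyManyMaximalBelow E.GraphInverseSemigroup ∧
        GraphGrading.LocallyStronglyGraded
          (GraphGrading.DirectedGraph.GraphInverseSemigroup.component E) ∧
        GraphGrading.SaturatedStronglyGraded
          (GraphGrading.DirectedGraph.GraphInverseSemigroup.component E)] := by
  rw [← GraphGrading.DirectedGraph.BoundaryPath.allShifts_iff,
    ← GraphGrading.DirectedGraph.BoundaryPath.allShifts_iff_stronglyGradedGroupoid,
    ← GraphGrading.DirectedGraph.GraphInverseSemigroup.allShifts_iff_stronglyGraded]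
  tfae_have 1 → 2 := fun H K _ =>
    GraphGrading.DirectedGraph.stronglyGradedRing_of_allShifts K H
  tfae_have 2 → 3 := fun h => ⟨ULift ℚ, inferInstance, h (ULift ℚ)⟩
  tfae_have 3 → 1 := fun ⟨K, _, h⟩ =>
    GraphGrading.DirectedGraph.allShifts_of_stronglyGradedRing K h
  tfae_have 1 ↔ 4 := Iff.rfl
  tfae_have 1 ↔ 5 := Iff.rfl
  tfae_finish
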